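/- Let $n\in\{2,3\}$, let $\Omega\subset\mathbb R^n$ be a convex polygonal (polyhedral) domain, $T>0$, $I=(0,T)$, and write $\|\cdot\|$ for the norm of $L^2(I,L^2(\Omega))$ and $a(u,v)=\int_\Omega\nabla u\cdot\nabla v\,dx$. Let $f\in L^2(I,H^{-1}(\Omega))$, $\kappa\in L^2(\Omega)$, and let $y\in L^2(I,H^1_0(\Omega))$ with $\partial_t y\in L^2(I,H^{-1}(\Omega))$ be the weak solution of $\partial_t y-\Delta y=f$ in $I\times\Omega$, $y=0$ on $I\times\partial\Omega$, $y(0)=\kappa$. Assume that (a) $f\in H^1(I,L^2(\Omega))$, $f(0)\in H^1_0(\Omega)$, $\kappa\in H^1_0(\Omega)$ and $\Delta\kappa\in H^1_0(\Omega)$; or (b) $y\in H^1(I,H^2(\Omega)\cap H^1_0(\Omega))\cap H^2(I,L^2(\Omega))$. Then $\partial_t^2y$ and $\partial_t\Delta y$ exist in $L^2(I,L^2(\Omega))$, and the following estimate holds with an absolute constant $C>0$ (independent of $n,\Omega,T$, of the data, of $y$ and of the time grid). For every partition $0=t_0<t_1<\dots<t_M=T$ with $k_m=t_m-t_{m-1}$,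 $I_m=[t_{m-1},t_m)$ and $k=\max_m k_m$, let $Y_k$ be the set of functions $v:[0,T]\to H^1_0(\Omega)$ that are constant on each $I_m$, and let $P_k$ be the set of $v\in C([0,T],H^1_0(\Omega))$ that are affine in time on each $I_m$. If $y_k\in Y_k$ is the Petrov–Galerkin solution, i.e. $$\int_0^T\big(-\langle\partial_t v_k,y_k\rangle+a(y_k,v_k)\big)\,dt+(y_k(T),v_k(T))_{L^2(\Omega)}=\int_0^T\langle f,v_k\rangle\,dt+(\kappa,v_k(0))_{L^2(\Omega)}\qquad\text{for all }v_k\in P_k,$$ then $$\|y_k-\mathcal P_{Y_k}y\|\le C\,k^2\left(\|\partial_t^2y\|+\|\partial_t\Delta y\|\right),$$ where $\mathcal P_{Y_k}y$ is the interval-mean projection, $\mathcal P_{Y_k}y|_{I_m}=\frac1{k_m}\int_{t_{m-1}}^{t_m}y\,dt$ for $m=1,\dots,M$ and $\mathcal P_{Y_k}y(T)=0$. -/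

import Mathlib

open MeasureTheory Set Filter Topology
open scoped ContDiff ENNReal Gradient

noncomputable section

namespace HeatPG

/-! ### Function spaces on the spatial domain -/

/-- Euclidean space `ℝⁿ`. -/
abbrev Space (n : ℕ) : Type := EuclideanSpace ℝ (Fin n)

/-- `Ω` is a (nonempty, open, bounded) convex polygonal / polyhedral domain: the interior of the
convex hull of finitely many points. -/
def IsConvexPolygonalDomain {n : ℕ} (Ω : Set (Space n)) : Prop :=
  Ω.Nonempty ∧ ∃ S : Set (Space n), S.Finite ∧ Ω = interior (convexHull ℝ S)

/-- `L²(Ω)`. -/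
abbrev L2 {n : ℕ} (Ω : Set (Space n)) : Type := Lp ℝ 2 (volume.restrict Ω)

/-- `L²(Ω; ℝⁿ)`, the space of square integrable vector fields. -/
abbrev L2Vec {n : ℕ} (Ω : Set (Space n)) : Type := Lp (Space n) 2 (volume.restrict Ω)

/-- Test functions: `φ ∈ C_c^∞(Ω)`. -/
structure IsTestFun {n : ℕ} (Ω : Set (Space n)) (φ : Space n → ℝ) : Prop where
  smooth : ContDiff ℝ ∞ φ
  compact : HasCompactSupport φ
  supp : tsupport φ ⊆ Ω

/-- The set of pairs `(φ, ∇φ)`, `φ ∈ C_c^∞(Ω)`, in `L²(Ω) × L²(Ω; ℝⁿ)` (Hilbert product). -/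
def testPairs {n : ℕ} (Ω : Set (Space n)) : Set (WithLp 2 (L2 Ω × L2Vec Ω)) :=
  {p | ∃ φ : Space n → ℝ, IsTestFun Ω φ ∧
    (p.fst : Space n → ℝ) =ᵐ[volume.restrict Ω] φ ∧
    (p.snd : Space n → Space n) =ᵐ[volume.restrict Ω] ∇ φ}

/-- `H¹₀(Ω)`: the closure of `C_c^∞(Ω)` in the `H¹` norm
`(‖u‖²_{L²} + ‖∇u‖²_{L²})^{1/2}`. An element is stored as the pair `(u, ∇u)`; the second component
is determined by the first, being its weak gradient. -/
abbrev H10 {n : ℕ} (Ω : Set (Space n)) : Submodule ℝ (WithLp 2 (L2 Ω × L2Vec Ω)) :=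
  (Submodule.span ℝ (testPairs Ω)).topologicalClosure

/-- The embedding `H¹₀(Ω) → L²(Ω)`. -/
def toL2 {n : ℕ} (Ω : Set (Space n)) : H10 Ω →L[ℝ] L2 Ω :=
  (WithLp.fstL 2 ℝ (L2 Ω) (L2Vec Ω)).comp (H10 Ω).subtypeL

/-- The weak gradient `∇ : H¹₀(Ω) → L²(Ω; ℝⁿ)`. -/
def grad {n : ℕ} (Ω : Set (Space n)) : H10 Ω →L[ℝ] L2Vec Ω :=
  (WithLp.sndL 2 ℝ (L2 Ω) (L2Vec Ω)).comp (H10 Ω).subtypeL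

/-- `H⁻¹(Ω)`, the dual of `H¹₀(Ω)`; the pairing `⟨f, v⟩` is the application `f v`. -/
abbrev Hneg1 {n : ℕ} (Ω : Set (Space n)) : Type := H10 Ω →L[ℝ] ℝ

/-- The embedding `L²(Ω) → H⁻¹(Ω)`, `w ↦ (v ↦ (w, v)_{L²})`. -/
def l2ToDual {n : ℕ} (Ω : Set (Space n)) (w : L2 Ω) : Hneg1 Ω :=
  (innerSL ℝ w).comp (toL2 Ω)

/-- The Dirichlet form `a(u, v) = ∫_Ω ∇u · ∇v`. -/
def dirichlet {n : ℕ} {Ω : Set (Space n)} (u v : H10 Ω) : ℝ :=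
  inner ℝ (grad Ω u) (grad Ω v)

/-- `Δu = w` weakly in `Ω`, for `u ∈ H¹₀(Ω)` and `w ∈ L²(Ω)`: `-∫ ∇u · ∇v = ∫ w v`. Since
`C_c^∞(Ω)` is dense in `H¹₀(Ω)`, testing with `v ∈ H¹₀(Ω)` is the same as testing with
`v ∈ C_c^∞(Ω)`. -/
def IsLaplacian {n : ℕ} {Ω : Set (Space n)} (u : H10 Ω) (w : L2 Ω) : Prop :=
  ∀ v : H10 Ω, -dirichlet u v = inner ℝ w (toL2 Ω v)

/-- The functions `h i j ∈ L²(Ω)` are the weak second derivatives `∂_j ∂_i u` of `u ∈ H¹₀(Ω)`;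
if such `h` exist then `u ∈ H²(Ω) ∩ H¹₀(Ω)`. -/
def IsWeakHessian {n : ℕ} {Ω : Set (Space n)} (u : H10 Ω) (h : Fin n → Fin n → L2 Ω) : Prop :=
  ∀ (i j : Fin n) (φ : Space n → ℝ), IsTestFun Ω φ →
    ∫ x in Ω, (grad Ω u : Space n → Space n) x i * (∇ φ x) j
      = -∫ x in Ω, (h i j : Space n → ℝ) x * φ x

/-! ### Functions of time -/

/-- Lebesgue measure on `I = (0, T)`; thus `v ∈ L²(I, X)` is `MemLp v 2 (timeMeasure T)`, and
`eLpNorm v 2 (timeMeasure T)` is the norm of `L²(I, X)`. -/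
abbrev timeMeasure (T : ℝ) : Measure ℝ := volume.restrict (Ioo 0 T)

/-- `u'` is the weak (distributional) time derivative of `u` on `(0, T)`. It is used for
`u, u' ∈ L²(I, X)` only. -/
def HasWeakTimeDeriv {X : Type*} [NormedAddCommGroup X] [NormedSpace ℝ X]
    (T : ℝ) (u u' : ℝ → X) : Prop :=
  ∀ φ : ℝ → ℝ, ContDiff ℝ ∞ φ → HasCompactSupport φ → tsupport φ ⊆ Ioo 0 T →
    ∫ s in Ioo 0 T, deriv φ s • u s = -∫ s in Ioo 0 T, φ s • u' s

/-- The representative of `u` in `C([0, T], X)` exists and has the value `x` at time `0`. -/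
def HasInitialValue {X : Type*} [NormedAddCommGroup X] (T : ℝ) (u : ℝ → X) (x : X) : Prop :=
  ∃ w : ℝ → X, ContinuousOn w (Icc 0 T) ∧ u =ᵐ[timeMeasure T] w ∧ w 0 = x

/-- `v' ∈ L²(I, H⁻¹(Ω))` is the weak time derivative of `v ∈ L²(I, H¹₀(Ω))`, so that
`v ∈ W(I)`. -/
structure MemW {n : ℕ} {Ω : Set (Space n)} (T : ℝ) (v : ℝ → H10 Ω) (v' : ℝ → Hneg1 Ω) :
    Prop where
  mem : MemLp v 2 (timeMeasure T)
  mem_deriv : MemLp v' 2 (timeMeasure T)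
  deriv : HasWeakTimeDeriv T (fun s => l2ToDual Ω (toL2 Ω (v s))) v'

/-- `y ∈ W(I)` is the weak solution of `∂ₜ y - Δy = f` in `I × Ω`, `y = 0` on `I × ∂Ω`,
`y(0) = κ`. -/
def IsWeakSolution {n : ℕ} {Ω : Set (Space n)} (T : ℝ) (f : ℝ → Hneg1 Ω) (κ : L2 Ω)
    (y : ℝ → H10 Ω) : Prop :=
  HasInitialValue T (fun s => toL2 Ω (y s)) κ ∧
  ∃ y' : ℝ → Hneg1 Ω, MemW T y y' ∧
    ∀ v : ℝ → H10 Ω, MemLp v 2 (timeMeasure T) →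
      ∫ s in Ioo 0 T, (y' s (v s) + dirichlet (y s) (v s)) = ∫ s in Ioo 0 T, f s (v s)

/-- `u ∈ L²(I, H²(Ω) ∩ H¹₀(Ω))`. -/
def MemL2H2 {n : ℕ} {Ω : Set (Space n)} (T : ℝ) (u : ℝ → H10 Ω) : Prop :=
  MemLp u 2 (timeMeasure T) ∧
  ∃ h : ℝ → Fin n → Fin n → L2 Ω, MemLp h 2 (timeMeasure T) ∧
    ∀ᵐ s ∂(timeMeasure T), IsWeakHessian (u s) (h s)

/-- `u ∈ H¹(I, H²(Ω) ∩ H¹₀(Ω))`. -/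
def MemH1H2 {n : ℕ} {Ω : Set (Space n)} (T : ℝ) (u : ℝ → H10 Ω) : Prop :=
  MemL2H2 T u ∧ ∃ u' : ℝ → H10 Ω, MemL2H2 T u' ∧ HasWeakTimeDeriv T u u'

/-- `u ∈ H¹(I, L²(Ω))` with `∂ₜ u = u'`. -/
structure IsH1TimeDeriv {n : ℕ} {Ω : Set (Space n)} (T : ℝ) (u u' : ℝ → L2 Ω) : Prop where
  mem : MemLp u 2 (timeMeasure T)
  mem_deriv : MemLp u' 2 (timeMeasure T)
  deriv : HasWeakTimeDeriv T u u'

/-- `y ∈ H²(I, L²(Ω))` with `∂ₜ² y = y''`. -/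
def IsSecondTimeDeriv {n : ℕ} {Ω : Set (Space n)} (T : ℝ) (y : ℝ → H10 Ω) (y'' : ℝ → L2 Ω) :
    Prop :=
  ∃ y' : ℝ → L2 Ω, IsH1TimeDeriv T (fun s => toL2 Ω (y s)) y' ∧ IsH1TimeDeriv T y' y''

/-- `Δy ∈ H¹(I, L²(Ω))` with `∂ₜ Δy = z`. -/
def IsTimeDerivLaplacian {n : ℕ} {Ω : Set (Space n)} (T : ℝ) (y : ℝ → H10 Ω) (z : ℝ → L2 Ω) :
    Prop :=
  ∃ l : ℝ → L2 Ω, (∀ᵐ s ∂(timeMeasure T), IsLaplacian (y s) (l s)) ∧ IsH1TimeDeriv T l z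

/-- The regularity of the data: `f ∈ H¹(I, L²(Ω))`, `f(0) ∈ H¹₀(Ω)`, `κ ∈ H¹₀(Ω)` and
`Δκ ∈ H¹₀(Ω)`. -/
def RegularData {n : ℕ} {Ω : Set (Space n)} (T : ℝ) (f : ℝ → Hneg1 Ω) (κ : L2 Ω) : Prop :=
  (∃ F F' : ℝ → L2 Ω, IsH1TimeDeriv T F F' ∧
    (∀ᵐ s ∂(timeMeasure T), f s = l2ToDual Ω (F s)) ∧
    ∃ g : H10 Ω, HasInitialValue T F (toL2 Ω g)) ∧
  ∃ κ₀ w : H10 Ω, toL2 Ω κ₀ = κ ∧ IsLaplacian κ₀ (toL2 Ω w)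

/-! ### The Petrov-Galerkin scheme -/

/-- `0 = t₀ < t₁ < ⋯ < t_M = T`. Only the values `t 0, …, t M` matter. -/
structure IsPartition (T : ℝ) (M : ℕ) (t : ℕ → ℝ) : Prop where
  zero : t 0 = 0
  last : t M = T
  lt : ∀ m < M, t m < t (m + 1)

/-- The mesh parameter `k = max_m (t_m - t_{m-1})`. -/
def meshSize (M : ℕ) (t : ℕ → ℝ) : ℝ := ⨆ m : Fin M, (t (m + 1) - t m)

/-- The Ansatz space `Y_k`: functions constant on each interval `[t_{m-1}, t_m)` with values in
`H¹₀(Ω)`. The value at `T` is arbitrary; values outside `[0, T]` play no role. -/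
def ansatzSpace {n : ℕ} (Ω : Set (Space n)) (M : ℕ) (t : ℕ → ℝ) : Set (ℝ → H10 Ω) :=
  {v | ∀ m < M, ∃ c : H10 Ω, ∀ s ∈ Ico (t m) (t (m + 1)), v s = c}

/-- The test space `P_k`: functions continuous on `[0, T]`, affine in time on each interval
`[t_{m-1}, t_m)`, with values in `H¹₀(Ω)`. Values outside `[0, T]` play no role. -/
def testSpace {n : ℕ} (Ω : Set (Space n)) (T : ℝ) (M : ℕ) (t : ℕ → ℝ) : Set (ℝ → H10 Ω) :=
  {v | ContinuousOn v (Icc 0 T) ∧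
    ∀ m < M, ∃ b c : H10 Ω, ∀ s ∈ Ico (t m) (t (m + 1)), v s = b + s • c}

/-- The bilinear form
`A(y, v) = ∫_0^T (-⟨∂ₜ v, y⟩ + a(y, v)) dt + (y(T), v(T))_{L²}`; the argument `v'` is `∂ₜ v`. -/
def formA {n : ℕ} {Ω : Set (Space n)} (T : ℝ) (y v : ℝ → H10 Ω) (v' : ℝ → Hneg1 Ω) : ℝ :=
  (∫ s in Ioo 0 T, (-(v' s (y s)) + dirichlet (y s) (v s)))
    + inner ℝ (toL2 Ω (y T)) (toL2 Ω (v T))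

/-- `y_k ∈ Y_k` solves `A(y_k, v_k) = ∫_0^T ⟨f, v_k⟩ dt + (κ, v_k(0))_{L²}` for all `v_k ∈ P_k`
(which have a weak time derivative `∂ₜ v_k ∈ L²(I, H⁻¹(Ω))`, unique almost everywhere). -/
def IsDiscreteSolution {n : ℕ} {Ω : Set (Space n)} (T : ℝ) (M : ℕ) (t : ℕ → ℝ)
    (f : ℝ → Hneg1 Ω) (κ : L2 Ω) (yk : ℝ → H10 Ω) : Prop :=
  yk ∈ ansatzSpace Ω M t ∧
  ∀ v ∈ testSpace Ω T M t, ∀ v' : ℝ → Hneg1 Ω, MemW T v v' →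
    formA T yk v v' = (∫ s in Ioo 0 T, f s (v s)) + inner ℝ κ (toL2 Ω (v 0))

/-- The interval-mean projection `𝒫_{Y_k}`: on `[t_{m-1}, t_m)` it takes the value
`k_m⁻¹ ∫_{t_{m-1}}^{t_m} v dt`, and it vanishes elsewhere, in particular at `T`. -/
def meanProj {n : ℕ} {Ω : Set (Space n)} (M : ℕ) (t : ℕ → ℝ) (v : ℝ → H10 Ω) : ℝ → H10 Ω :=
  fun s => ∑ m ∈ Finset.range M, (Ico (t m) (t (m + 1))).indicator
    (fun _ => (t (m + 1) - t m)⁻¹ • ∫ r in (t m)..(t (m + 1)), v r) s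

end HeatPG

end

open HeatPG

set_option linter.unusedSectionVars false

namespace HeatPG

/-! ### Primitives, weak time derivatives and integration by parts. -/

section Primitives

variable {X Y Z : Type*} [NormedAddCommGroup X]

/-! The error bound is a duality argument, carried out for Hilbert spaces with maps `J : V → H`
(embedding) and `D : V → E` (gradient) such that `(u, v)_V = (J u, J v) + (D u, D v)`. Let `e m` be
the value of `y_k` minus the mean of `y` on the `m`-th interval. `exists_dual_solution` solves the
adjoint scheme backwards in time with right-hand side `e`; its solution is continuous, piecewise
affine, has nodal values `W` with `W M = 0`, and its slopes are bounded in `H` by `e`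
(`dual_stability`). Insert it into the discrete and the continuous weak equation and subtract. On
each interval it is its midpoint value plus `s - midpoint` times the slope. The slope and the
midpoint value are paired only with the integral of `y_k - y`, which produces `k_m ‖J (e m)‖²`; the
linear part does not see the constant `y_k`. Hence the squared error is `∑ ∫ (s - midpoint) (D y, D
slope) ds`. Here `-(D y, D slope) = (Δy, J slope)`, and since the weight has mean zero only the
variation of `Δy` over the interval counts: the weight and the variation each supply one power of
`k` (`integral_sub_midpoint_mul_le`). `sum_error_le` absorbs the slopes, so that `‖∂ₜΔy‖` alone
bounds the error, with constant one.

It remains to find the derivatives. In case (b) the Laplacian is the trace of the Hessian and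
commutes with the weak time derivative (`hasWeakTimeDeriv_laplacian`). In case (a) the expected
derivative `z = ∂ₜy` solves `z' - Δz = F'` with initial value `f(0) + Δκ` in `H¹₀`. Maximal
regularity (`exists_maximal_regularity`) provides such a `z`; its time integral starting from `κ`
solves the original problem and so equals `y` by uniqueness (`ae_eq_zero_of_integrated_heat`). Then
`∂ₜ²y = z'` and `∂ₜΔy = z' - F'`. Maximal regularity itself follows from a closed-range argument: an
energy bound closes the range of admissible data, and orthogonality shows that the range is
everything. -/

theorem _root_.MeasureTheory.MemLp.integrableOn_Ioc {T : ℝ} {u : ℝ → X} (hu : MemLp u 2 (timeMeasure T)) :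
    IntegrableOn u (Ioc 0 T) := by
  rw [integrableOn_Ioc_iff_integrableOn_Ioo]
  exact hu.integrable (by norm_num)

theorem memLp_of_continuousOn {T : ℝ} {w : ℝ → X} (hw : ContinuousOn w (Icc 0 T)) :
    MemLp w 2 (timeMeasure T) := by
  obtain ⟨C, hC⟩ := isCompact_Icc.exists_bound_of_continuousOn hw
  refine MemLp.of_bound ?_ C ?_
  · exact (hw.aestronglyMeasurable measurableSet_Icc).mono_measure
      (Measure.restrict_mono Ioo_subset_Icc_self le_rfl)
  · filter_upwards [ae_restrict_mem measurableSet_Ioo] with s hs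
    exact hC s (Ioo_subset_Icc_self hs)

theorem eq_of_ae_eq_of_continuousOn {T : ℝ} (hT : 0 < T) {f g : ℝ → X}
    (hf : ContinuousOn f (Icc 0 T)) (hg : ContinuousOn g (Icc 0 T))
    (h : ∀ᵐ s ∂timeMeasure T, f s = g s) {s : ℝ} (hs : s ∈ Icc 0 T) : f s = g s := by
  refine Measure.eqOn_Icc_of_ae_eq (μ := volume) hT.ne ?_ hf hg hs
  rw [← Measure.restrict_congr_set Ioo_ae_eq_Icc]
  exact h

variable [NormedSpace ℝ X]

/-- The primitive of `u` vanishing at time `0`. -/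
noncomputable def prim (u : ℝ → X) (s : ℝ) : X :=
  ∫ r in (0 : ℝ)..s, u r

theorem integral_Ioo_eq_interval {T : ℝ} (hT : 0 < T) (u : ℝ → X) :
    ∫ s in Ioo 0 T, u s = ∫ s in (0 : ℝ)..T, u s := by
  rw [intervalIntegral.integral_of_le hT.le, integral_Ioc_eq_integral_Ioo]

theorem continuousOn_prim {T : ℝ} {u : ℝ → X} (hu : IntegrableOn u (Ioc 0 T)) :
    ContinuousOn (prim u) (Icc 0 T) :=
  (intervalIntegral.continuousOn_primitive
    ((integrableOn_Icc_iff_integrableOn_Ioc (μ := volume)).2 hu)).congr fun _ hx =>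
    intervalIntegral.integral_of_le hx.1

theorem prim_congr {T : ℝ} {u v : ℝ → X} (h : ∀ᵐ s ∂timeMeasure T, u s = v s) {s : ℝ}
    (hs : s ∈ Icc 0 T) : prim u s = prim v s := by
  rw [prim, prim, intervalIntegral.integral_of_le hs.1, intervalIntegral.integral_of_le hs.1,
    integral_Ioc_eq_integral_Ioo, integral_Ioc_eq_integral_Ioo]
  exact integral_congr_ae (ae_restrict_of_ae_restrict_of_subset (Ioo_subset_Ioo_right hs.2) h)

theorem prim_add {T : ℝ} {u v : ℝ → X} (hu : IntegrableOn u (Ioc 0 T))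
    (hv : IntegrableOn v (Ioc 0 T)) {s : ℝ} (hs : s ∈ Icc 0 T) :
    prim (fun r => u r + v r) s = prim u s + prim v s := by
  have hsub : Ioc 0 s ⊆ Ioc 0 T := Ioc_subset_Ioc_right hs.2
  refine intervalIntegral.integral_add ?_ ?_
  · exact (intervalIntegrable_iff_integrableOn_Ioc_of_le hs.1).2 (hu.mono_set hsub)
  · exact (intervalIntegrable_iff_integrableOn_Ioc_of_le hs.1).2 (hv.mono_set hsub)

theorem prim_sub {T : ℝ} {u v : ℝ → X} (hu : IntegrableOn u (Ioc 0 T))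
    (hv : IntegrableOn v (Ioc 0 T)) {s : ℝ} (hs : s ∈ Icc 0 T) :
    prim (fun r => u r - v r) s = prim u s - prim v s := by
  have hsub : Ioc 0 s ⊆ Ioc 0 T := Ioc_subset_Ioc_right hs.2
  refine intervalIntegral.integral_sub ?_ ?_
  · exact (intervalIntegrable_iff_integrableOn_Ioc_of_le hs.1).2 (hu.mono_set hsub)
  · exact (intervalIntegrable_iff_integrableOn_Ioc_of_le hs.1).2 (hv.mono_set hsub)

variable [CompleteSpace X] [NormedAddCommGroup Y] [NormedSpace ℝ Y] [CompleteSpace Y]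
  [NormedAddCommGroup Z] [NormedSpace ℝ Z] [CompleteSpace Z]

/-- Fubini for `B (g s) (d r)` on the square `(a, b]²` cut along its diagonal: integration by parts
for primitives of merely integrable functions. -/
theorem integral_bilin_primitive (B : X →L[ℝ] Y →L[ℝ] Z) {a b : ℝ} (hab : a ≤ b)
    {g : ℝ → X} {d : ℝ → Y} (hg : IntegrableOn g (Ioc a b)) (hd : IntegrableOn d (Ioc a b)) :
    ∫ s in a..b, B (g s) (∫ r in a..s, d r)
      = B (∫ s in a..b, g s) (∫ s in a..b, d s) - ∫ r in a..b, B (∫ s in a..r, g s) (d r) := by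
  set μ : Measure ℝ := volume.restrict (Ioc a b) with hμ
  have hF : Integrable (fun z : ℝ × ℝ => B (g z.1) (d z.2)) (μ.prod μ) :=
    Integrable.op_fst_snd (by fun_prop) ⟨‖B‖, B.le_opNorm₂⟩ hg hd
  have hP : MeasurableSet {z : ℝ × ℝ | z.2 ≤ z.1} := measurableSet_le measurable_snd measurable_fst
  have hlow : ∀ᵐ s ∂μ, ∫ r, {z : ℝ × ℝ | z.2 ≤ z.1}.indicator
      (fun z : ℝ × ℝ => B (g z.1) (d z.2)) (s, r) ∂μ = B (g s) (∫ r in a..s, d r) := by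
    filter_upwards [ae_restrict_mem measurableSet_Ioc] with s hs
    have h1 : (fun r => {z : ℝ × ℝ | z.2 ≤ z.1}.indicator
        (fun z : ℝ × ℝ => B (g z.1) (d z.2)) (s, r)) = (Iic s).indicator fun r => B (g s) (d r) := by
      ext r
      simp [indicator]
    rw [h1, integral_indicator measurableSet_Iic, hμ, Measure.restrict_restrict measurableSet_Iic,
      intervalIntegral.integral_of_le hs.1.le]
    have h2 : Iic s ∩ Ioc a b = Ioc a s := by
      ext r
      simp only [mem_inter_iff, mem_Iic, mem_Ioc]
      exact ⟨fun h => ⟨h.2.1, h.1⟩, fun h => ⟨h.2, h.1, h.2.trans hs.2⟩⟩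
    rw [h2]
    exact (B (g s)).integral_comp_comm (hd.mono_set (Ioc_subset_Ioc_right hs.2))
  have hupp : ∀ᵐ r ∂μ, ∫ s, {z : ℝ × ℝ | z.2 ≤ z.1}ᶜ.indicator
      (fun z : ℝ × ℝ => B (g z.1) (d z.2)) (s, r) ∂μ = B (∫ s in a..r, g s) (d r) := by
    filter_upwards [ae_restrict_mem measurableSet_Ioc] with r hr
    have h1 : (fun s => {z : ℝ × ℝ | z.2 ≤ z.1}ᶜ.indicator
        (fun z : ℝ × ℝ => B (g z.1) (d z.2)) (s, r))
          = (Iio r).indicator fun s => B.flip (d r) (g s) := by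
      ext s
      simp [indicator]
    rw [h1, integral_indicator measurableSet_Iio, hμ, Measure.restrict_restrict measurableSet_Iio,
      intervalIntegral.integral_of_le hr.1.le, integral_Ioc_eq_integral_Ioo]
    have h2 : Iio r ∩ Ioc a b = Ioo a r := by
      ext s
      simp only [mem_inter_iff, mem_Iio, mem_Ioc, mem_Ioo]
      exact ⟨fun h => ⟨h.2.1, h.1⟩, fun h => ⟨h.2, h.1, h.2.le.trans hr.2⟩⟩
    rw [h2, (B.flip (d r)).integral_comp_comm
      (hg.mono_set (Ioo_subset_Ioc_self.trans (Ioc_subset_Ioc_right hr.2)))]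
    rfl
  have hsum : ∫ z, B (g z.1) (d z.2) ∂(μ.prod μ)
      = ∫ z, {z : ℝ × ℝ | z.2 ≤ z.1}.indicator (fun z : ℝ × ℝ => B (g z.1) (d z.2)) z ∂(μ.prod μ)
        + ∫ z, {z : ℝ × ℝ | z.2 ≤ z.1}ᶜ.indicator
            (fun z : ℝ × ℝ => B (g z.1) (d z.2)) z ∂(μ.prod μ) := by
    rw [integral_indicator hP, integral_indicator hP.compl, integral_add_compl hP hF]
  rw [integral_prod_bilin B hg hd, integral_prod _ (hF.indicator hP),
    integral_prod_symm _ (hF.indicator hP.compl), integral_congr_ae hlow,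
    integral_congr_ae hupp] at hsum
  rw [intervalIntegral.integral_of_le hab, intervalIntegral.integral_of_le hab,
    intervalIntegral.integral_of_le hab, intervalIntegral.integral_of_le hab, hsum,
    add_sub_cancel_right]


theorem testFun_eq_prim_deriv {T : ℝ} {φ : ℝ → ℝ} (hφ : ContDiff ℝ ∞ φ)
    (hs : tsupport φ ⊆ Ioo 0 T) (r : ℝ) : prim (deriv φ) r = φ r := by
  have h0 : φ 0 = 0 := image_eq_zero_of_notMem_tsupport fun h => (hs h).1.false
  rw [prim, intervalIntegral.integral_deriv_eq_sub, h0, sub_zero]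
  · exact fun x _ => (hφ.differentiable (by simp)).differentiableAt
  · exact ((hφ.continuous_deriv (by simp))).intervalIntegrable _ _

/-- Integration by parts against `φ = prim (deriv φ)`; the boundary terms and the constant `c` drop
out because `φ` vanishes at both ends. -/
theorem hasWeakTimeDeriv_of_eq_prim {T : ℝ} (hT : 0 < T) {u u' : ℝ → X} (c : X)
    (hu' : IntegrableOn u' (Ioc 0 T)) (hu : ∀ᵐ s ∂timeMeasure T, u s = c + prim u' s) :
    HasWeakTimeDeriv T u u' := by
  intro φ hφ hc hs
  have hφ' : Continuous (deriv φ) := hφ.continuous_deriv (by simp)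
  have hT0 : φ T = 0 := image_eq_zero_of_notMem_tsupport fun h => (hs h).2.false
  have h1 : ∫ s in Ioo 0 T, deriv φ s • u s = ∫ s in Ioo 0 T, (deriv φ s • c + deriv φ s • prim u' s) :=
    integral_congr_ae (by filter_upwards [hu] with s hs; rw [hs, smul_add])
  have hi : IntervalIntegrable (fun s => deriv φ s • prim u' s) volume 0 T := by
    apply ContinuousOn.intervalIntegrable
    rw [uIcc_of_le hT.le]
    exact hφ'.continuousOn.smul (continuousOn_prim hu')
  have h2 := integral_bilin_primitive (ContinuousLinearMap.lsmul ℝ ℝ) hT.le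
    (hφ'.integrableOn_Ioc (μ := volume)) hu'
  have h3 : ∫ s in (0 : ℝ)..T, deriv φ s = 0 := by
    have h := testFun_eq_prim_deriv hφ hs T
    rwa [hT0] at h
  have h4 (r : ℝ) : ∫ s in (0 : ℝ)..r, deriv φ s = φ r := testFun_eq_prim_deriv hφ hs r
  have hi' : IntervalIntegrable (fun s => deriv φ s • c) volume 0 T :=
    (hφ'.smul continuous_const).intervalIntegrable _ _
  rw [h1, integral_Ioo_eq_interval hT, intervalIntegral.integral_add hi' hi, intervalIntegral.integral_smul_const,
    h3, zero_smul, zero_add, integral_Ioo_eq_interval hT]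
  simp only [ContinuousLinearMap.lsmul_apply, h3, h4, zero_smul, zero_sub] at h2
  exact h2

theorem ae_eq_zero_of_testFun {T : ℝ} {w : ℝ → X} (hw : IntegrableOn w (Ioc 0 T))
    (h : ∀ φ : ℝ → ℝ, ContDiff ℝ ∞ φ → HasCompactSupport φ → tsupport φ ⊆ Ioo 0 T →
      ∫ s in Ioo 0 T, φ s • w s = 0) : ∀ᵐ s ∂timeMeasure T, w s = 0 := by
  rw [ae_restrict_iff' measurableSet_Ioo]
  refine isOpen_Ioo.ae_eq_zero_of_integral_contDiff_smul_eq_zero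
    (hw.mono_set Ioo_subset_Ioc_self).locallyIntegrableOn fun φ hφ hc hs => ?_
  rw [← h φ hφ hc hs, setIntegral_eq_integral_of_forall_compl_eq_zero]
  intro x hx
  rw [image_eq_zero_of_notMem_tsupport fun h => hx (hs h), zero_smul]

/-- The primitive of `χ` vanishes to the left of `K`, and to the right of it because `χ` has mean
zero. -/
theorem exists_testFun_deriv_eq {T : ℝ} {χ : ℝ → ℝ} (hχ : ContDiff ℝ ∞ χ) {K : Set ℝ}
    (hK : IsCompact K) (hKT : K ⊆ Ioo 0 T) (hχK : ∀ s ∉ K, χ s = 0)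
    (h0 : ∫ s, χ s = 0) : ∃ φ : ℝ → ℝ, ContDiff ℝ ∞ φ ∧ HasCompactSupport φ ∧
      tsupport φ ⊆ Ioo 0 T ∧ deriv φ = χ := by
  rcases K.eq_empty_or_nonempty with rfl | hne
  · refine ⟨0, contDiff_const, HasCompactSupport.zero, ?_, ?_⟩
    · simp [tsupport]
    · ext s
      rw [hχK s (notMem_empty s)]
      simp
  obtain ⟨α, hα, hαl⟩ := hK.exists_isLeast hne
  obtain ⟨β, hβ, hβu⟩ := hK.exists_isGreatest hne
  have hd (s : ℝ) : HasDerivAt (prim χ) (χ s) s :=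
    intervalIntegral.integral_hasDerivAt_right (hχ.continuous.intervalIntegrable _ _)
      (hχ.continuous.stronglyMeasurableAtFilter _ _) hχ.continuous.continuousAt
  have hder : deriv (prim χ) = χ := funext fun s => (hd s).deriv
  have hout : ∀ s ∉ Icc α β, prim χ s = 0 := by
    intro s hs
    rcases lt_or_ge s α with h | h
    · refine intervalIntegral.integral_zero_ae (ae_of_all _ fun r hr => hχK r fun hrK => ?_)
      rw [mem_uIoc] at hr
      have := hαl hrK
      have := (hKT hα).1
      have := (hKT hrK).1
      rcases hr with hr | hr <;> linarith [hr.1, hr.2]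
    · have hβs : β < s := by
        by_contra hb
        exact hs ⟨h, not_lt.1 hb⟩
      have h0s : 0 ≤ s := (hKT hβ).1.le.trans hβs.le
      rw [prim, intervalIntegral.integral_of_le h0s, setIntegral_eq_integral_of_forall_compl_eq_zero,
        h0]
      intro r hr
      refine hχK r fun hrK => hr ⟨(hKT hrK).1, (hβu hrK).trans hβs.le⟩
  have hsupp : tsupport (prim χ) ⊆ Icc α β :=
    closure_minimal (fun s hs => by_contra fun h => hs (hout s h)) isClosed_Icc
  refine ⟨prim χ, ?_, isCompact_Icc.of_isClosed_subset (isClosed_tsupport _) hsupp,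
    hsupp.trans (Icc_subset_Ioo (hKT hα).1 (hKT hβ).2), hder⟩
  rw [contDiff_infty_iff_deriv, hder]
  exact ⟨fun s => (hd s).differentiableAt, hχ⟩

/-- The du Bois-Reymond lemma. -/
theorem exists_ae_eq_const {T : ℝ} (hT : 0 < T) {w : ℝ → X} (hw : IntegrableOn w (Ioc 0 T))
    (h : HasWeakTimeDeriv T w 0) : ∃ c, ∀ᵐ s ∂timeMeasure T, w s = c := by
  let b : ContDiffBump (T / 2) := ⟨T / 8, T / 4, by positivity, by linarith⟩
  set ρ : ℝ → ℝ := b.normed volume with hρdef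
  have hρ : ContDiff ℝ ∞ ρ := b.contDiff_normed
  have hρc : HasCompactSupport ρ := b.hasCompactSupport_normed
  have hρs : tsupport ρ ⊆ Ioo 0 T := by
    rw [hρdef, b.tsupport_normed_eq, Real.closedBall_eq_Icc]
    have : b.rOut = T / 4 := rfl
    exact Icc_subset_Ioo (by linarith) (by linarith)
  have hint {φ : ℝ → ℝ} (hφ : Continuous φ) : IntegrableOn (fun s => φ s • w s) (Ioo 0 T) := by
    obtain ⟨C, hC⟩ := isCompact_Icc.exists_bound_of_continuousOn (hφ.continuousOn (s := Icc 0 T))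
    refine (hw.mono_set Ioo_subset_Ioc_self).bdd_smul C hφ.aestronglyMeasurable ?_
    filter_upwards [ae_restrict_mem measurableSet_Ioo] with s hs
    exact hC s (Ioo_subset_Icc_self hs)
  set c : X := ∫ s in Ioo 0 T, ρ s • w s with hcdef
  refine ⟨c, ?_⟩
  have key : ∀ᵐ s ∂timeMeasure T, w s - c = 0 := by
    refine ae_eq_zero_of_testFun (w := fun s => w s - c) (hw.sub (integrableOn_const (by simp)))
      fun ψ hψ hψc hψs => ?_
    have hψi : ∫ s in Ioo 0 T, ψ s = ∫ s, ψ s := by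
      refine setIntegral_eq_integral_of_forall_compl_eq_zero fun x hx => ?_
      exact image_eq_zero_of_notMem_tsupport fun h => hx (hψs h)
    -- Subtracting `(∫ ψ) ρ` removes the mean of `ψ`, so the difference is the derivative of a test
    -- function; this is why the constant is the `ρ`-average of `w`.
    obtain ⟨φ, hφ, hφc, hφs, hφd⟩ := exists_testFun_deriv_eq (T := T)
      (χ := fun s => ψ s - (∫ r, ψ r) * ρ s) (K := tsupport ψ ∪ tsupport ρ)
      (hψ.sub (contDiff_const.mul hρ)) (hψc.isCompact.union hρc.isCompact)
      (union_subset hψs hρs) (by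
        intro s hs
        rw [mem_union, not_or] at hs
        simp [image_eq_zero_of_notMem_tsupport hs.1, image_eq_zero_of_notMem_tsupport hs.2])
      (by
        rw [integral_sub (hψ.continuous.integrable_of_hasCompactSupport hψc)
          ((hρ.continuous.integrable_of_hasCompactSupport hρc).const_mul _), integral_const_mul,
          hρdef, b.integral_normed, mul_one, sub_self])
    have h1 := h φ hφ hφc hφs
    rw [hφd] at h1
    simp only [sub_smul, mul_smul, Pi.zero_apply, smul_zero, integral_zero, neg_zero] at h1
    have hρi : IntegrableOn (fun s => (∫ r, ψ r) • ρ s • w s) (Ioo 0 T) :=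
      (hint hρ.continuous).smul _
    rw [integral_sub (hint hψ.continuous) hρi, integral_smul, ← hcdef] at h1
    simp only [smul_sub]
    rw [integral_sub (hint hψ.continuous) (((hψ.continuous.integrable_of_hasCompactSupport
      hψc).integrableOn).smul_const c), integral_smul_const, hψi, h1]
  filter_upwards [key] with s hs
  exact sub_eq_zero.1 hs

theorem eq_prim_of_hasWeakTimeDeriv {T : ℝ} (hT : 0 < T) {u u' : ℝ → X}
    (hu : IntegrableOn u (Ioc 0 T)) (hu' : IntegrableOn u' (Ioc 0 T))
    (h : HasWeakTimeDeriv T u u') : ∃ c, ∀ᵐ s ∂timeMeasure T, u s = c + prim u' s := by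
  have hp : IntegrableOn (prim u') (Ioc 0 T) :=
    (memLp_of_continuousOn (continuousOn_prim hu')).integrableOn_Ioc
  obtain ⟨c, hc⟩ := exists_ae_eq_const hT (w := fun s => u s - prim u' s) (hu.sub hp) (by
    intro φ hφ hc hs
    have h1 := h φ hφ hc hs
    have h2 := hasWeakTimeDeriv_of_eq_prim hT (u := prim u') 0 hu' (by simp) φ hφ hc hs
    have hφ' : Continuous (deriv φ) := hφ.continuous_deriv (by simp)
    obtain ⟨C, hC⟩ := isCompact_Icc.exists_bound_of_continuousOn (hφ'.continuousOn (s := Icc 0 T))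
    have hint {v : ℝ → X} (hv : IntegrableOn v (Ioc 0 T)) :
        IntegrableOn (fun s => deriv φ s • v s) (Ioo 0 T) := by
      refine (hv.mono_set Ioo_subset_Ioc_self).bdd_smul C hφ'.aestronglyMeasurable ?_
      filter_upwards [ae_restrict_mem measurableSet_Ioo] with s hs
      exact hC s (Ioo_subset_Icc_self hs)
    simp only [smul_sub]
    rw [integral_sub (hint hu) (hint hp), h1, h2]
    simp)
  refine ⟨c, ?_⟩
  filter_upwards [hc] with s hs
  rw [← hs]; abel

theorem map_prim (L : X →L[ℝ] Y) {T : ℝ} {u : ℝ → X} (hu : IntegrableOn u (Ioc 0 T)) {s : ℝ}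
    (hs : s ∈ Icc 0 T) : L (prim u s) = prim (fun r => L (u r)) s :=
  (L.intervalIntegral_comp_comm ((intervalIntegrable_iff_integrableOn_Ioc_of_le hs.1).2
    (hu.mono_set (Ioc_subset_Ioc_right hs.2)))).symm

/-- The zero function then has weak derivative `u`, so `u` is orthogonal to all test functions. -/
theorem ae_eq_zero_of_prim_eq_zero {T : ℝ} (hT : 0 < T) {u : ℝ → X}
    (hu : IntegrableOn u (Ioc 0 T)) (h : ∀ s ∈ Icc 0 T, prim u s = 0) :
    ∀ᵐ s ∂timeMeasure T, u s = 0 := by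
  refine ae_eq_zero_of_testFun hu fun φ hφ hc hs => ?_
  have h1 := hasWeakTimeDeriv_of_eq_prim hT (u := fun _ => 0) 0 hu (by
    filter_upwards [ae_restrict_mem measurableSet_Ioo] with s hs
    rw [h s (Ioo_subset_Icc_self hs), add_zero]) φ hφ hc hs
  simpa using h1.symm

/-- A function with a weak time derivative is the primitive of that derivative, shifted by the
initial value. -/
theorem eq_add_prim_of_hasInitialValue {T : ℝ} (hT : 0 < T) {u u' w : ℝ → X}
    (hw : ContinuousOn w (Icc 0 T)) (huw : u =ᵐ[timeMeasure T] w)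
    (hu' : IntegrableOn u' (Ioc 0 T)) (h : HasWeakTimeDeriv T u u') {s : ℝ} (hs : s ∈ Icc 0 T) :
    w s = w 0 + prim u' s := by
  have hu : IntegrableOn u (Ioc 0 T) := ((memLp_congr_ae huw).2 (memLp_of_continuousOn hw)).integrableOn_Ioc
  obtain ⟨c, hc⟩ := eq_prim_of_hasWeakTimeDeriv hT hu hu' h
  have hall : ∀ r ∈ Icc 0 T, w r = c + prim u' r := fun r hr =>
    eq_of_ae_eq_of_continuousOn hT hw (continuousOn_const.add (continuousOn_prim hu'))
      (by filter_upwards [huw, hc] with r h1 h2; rw [← h1, h2]; rfl) hr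
  rw [hall s hs, hall 0 ⟨le_rfl, hT.le⟩]
  simp [prim]

end Primitives

/-! ### The energy identity, the Volterra operator and maximal regularity. -/

section MaximalRegularity

variable {H V : Type*} [NormedAddCommGroup H] [InnerProductSpace ℝ H] [CompleteSpace H]
  [NormedAddCommGroup V] [InnerProductSpace ℝ V] [CompleteSpace V]

/-- The integrated form of `d/ds ‖b + ∫ g‖² / 2 = (g, b + ∫ g)`. By symmetry of the inner product,
integration by parts returns the same integral with the opposite sign. -/
theorem integral_inner_add_prim {T : ℝ} (hT : 0 < T) {g : ℝ → V} (hg : IntegrableOn g (Ioc 0 T))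
    (b : V) :
    ∫ s in (0 : ℝ)..T, inner ℝ (g s) (b + prim g s) = (‖b + prim g T‖ ^ 2 - ‖b‖ ^ 2) / 2 := by
  have hi : IntervalIntegrable g volume 0 T := (intervalIntegrable_iff_integrableOn_Ioc_of_le hT.le).2 hg
  have h1 := integral_bilin_primitive (innerSL ℝ (E := V)) hT.le hg hg
  have hp : IntervalIntegrable (fun s => inner ℝ (g s) (prim g s)) volume 0 T := by
    rw [intervalIntegrable_iff_integrableOn_Ioc_of_le hT.le]
    obtain ⟨C, hC⟩ := isCompact_Icc.exists_bound_of_continuousOn (continuousOn_prim hg)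
    have hm : AEStronglyMeasurable (prim g) (volume.restrict (Ioc 0 T)) :=
      ((continuousOn_prim hg).aestronglyMeasurable measurableSet_Icc).mono_measure
        (Measure.restrict_mono Ioc_subset_Icc_self le_rfl)
    refine Integrable.mono' (hg.norm.mul_const C) (hg.aestronglyMeasurable.inner hm) ?_
    filter_upwards [ae_restrict_mem measurableSet_Ioc] with s hs
    exact (norm_inner_le_norm _ _).trans
      (mul_le_mul_of_nonneg_left (hC s (Ioc_subset_Icc_self hs)) (norm_nonneg _))
  have hb : IntervalIntegrable (fun s => inner ℝ (g s) b) volume 0 T := by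
    rw [intervalIntegrable_iff_integrableOn_Ioc_of_le hT.le]
    exact hg.inner_const b
  have h2 : ∫ s in (0 : ℝ)..T, inner ℝ (g s) b = inner ℝ (prim g T) b := by
    rw [prim]
    simp_rw [real_inner_comm b]
    exact (innerSL ℝ b).intervalIntegral_comp_comm hi
  change ∫ s in (0 : ℝ)..T, inner ℝ (g s) (prim g s) = inner ℝ (prim g T) (prim g T)
    - ∫ s in (0 : ℝ)..T, inner ℝ (prim g s) (g s) at h1
  simp_rw [fun s => real_inner_comm (g s) (prim g s)] at h1
  simp_rw [inner_add_right]
  rw [intervalIntegral.integral_add hb hp, h2, norm_add_sq_real, real_inner_comm b]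
  rw [real_inner_self_eq_norm_sq] at h1
  linarith

/-- Cauchy–Schwarz against the constant one, read off from the discriminant of `t ↦ ∫ (‖u‖ - t)²`.
-/
theorem sq_integral_norm_le {α E : Type*} [MeasurableSpace α] {μ : Measure α} [IsFiniteMeasure μ]
    [NormedAddCommGroup E] {u : α → E} (hu : MemLp u 2 μ) :
    (∫ x, ‖u x‖ ∂μ) ^ 2 ≤ μ.real univ * ∫ x, ‖u x‖ ^ 2 ∂μ := by
  have h1 : Integrable (fun x => ‖u x‖) μ := (hu.integrable (by norm_num)).norm
  have h2 : Integrable (fun x => ‖u x‖ ^ 2) μ := hu.norm.integrable_sq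
  have h : ∀ t : ℝ, 0 ≤ μ.real univ * (t * t) + (-2 * ∫ x, ‖u x‖ ∂μ) * t + ∫ x, ‖u x‖ ^ 2 ∂μ := by
    intro t
    have h3 : 0 ≤ ∫ x, (‖u x‖ - t) ^ 2 ∂μ := integral_nonneg fun x => sq_nonneg _
    have h4 : (fun x => (‖u x‖ - t) ^ 2) = fun x => (‖u x‖ ^ 2 - 2 * t * ‖u x‖) + t * t := by
      ext x; ring
    have h5 : Integrable (fun x => ‖u x‖ ^ 2 - 2 * t * ‖u x‖) μ := h2.sub (h1.const_mul _)
    rw [h4, integral_add h5 (integrable_const _),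
      integral_sub h2 (h1.const_mul _), integral_const_mul, integral_const, smul_eq_mul] at h3
    linarith
  have := discrim_le_zero h
  rw [discrim] at this
  linarith

theorem norm_sq_Lp_two {α : Type*} [MeasurableSpace α] {μ : Measure α} (u : Lp H 2 μ) :
    ‖u‖ ^ 2 = ∫ x, ‖u x‖ ^ 2 ∂μ := by
  rw [← real_inner_self_eq_norm_sq, L2.inner_def]
  simp_rw [real_inner_self_eq_norm_sq]

theorem norm_prim_le {T : ℝ} {u : ℝ → H} (hu : IntegrableOn u (Ioc 0 T)) {s : ℝ}
    (hs : s ∈ Icc 0 T) : ‖prim u s‖ ≤ ∫ r, ‖u r‖ ∂timeMeasure T := by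
  rw [prim, intervalIntegral.integral_of_le hs.1, timeMeasure, ← integral_Ioc_eq_integral_Ioo]
  exact (norm_integral_le_integral_norm _).trans (setIntegral_mono_set hu.norm
    (ae_of_all _ fun r => norm_nonneg _) (Ioc_subset_Ioc_right hs.2).eventuallyLE)

/-- Integration in time from `0`, as an operator on `L²(0, T; H)`. -/
noncomputable def volterra (H : Type*) [NormedAddCommGroup H] [InnerProductSpace ℝ H]
    [CompleteSpace H] {T : ℝ} (hT : 0 < T) :
    Lp H 2 (timeMeasure T) →L[ℝ] Lp H 2 (timeMeasure T) :=
  LinearMap.mkContinuous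
    { toFun := fun u => (memLp_of_continuousOn (continuousOn_prim (Lp.memLp u).integrableOn_Ioc)).toLp
        (prim u)
      map_add' := by
        intro u v
        ext1
        filter_upwards [MemLp.coeFn_toLp (memLp_of_continuousOn (T := T)
            (continuousOn_prim (Lp.memLp (u + v)).integrableOn_Ioc)),
          MemLp.coeFn_toLp (memLp_of_continuousOn (T := T) (continuousOn_prim (Lp.memLp u).integrableOn_Ioc)),
          MemLp.coeFn_toLp (memLp_of_continuousOn (T := T) (continuousOn_prim (Lp.memLp v).integrableOn_Ioc)),
          Lp.coeFn_add ((memLp_of_continuousOn (T := T)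
            (continuousOn_prim (Lp.memLp u).integrableOn_Ioc)).toLp (prim u))
            ((memLp_of_continuousOn (T := T) (continuousOn_prim (Lp.memLp v).integrableOn_Ioc)).toLp (prim v)),
          ae_restrict_mem measurableSet_Ioo] with s h1 h2 h3 h4 hs
        rw [h1, h4, Pi.add_apply, h2, h3, prim_congr (Lp.coeFn_add u v) (Ioo_subset_Icc_self hs)]
        exact prim_add (Lp.memLp u).integrableOn_Ioc (Lp.memLp v).integrableOn_Ioc
          (Ioo_subset_Icc_self hs)
      map_smul' := by
        intro c u
        ext1
        filter_upwards [MemLp.coeFn_toLp (memLp_of_continuousOn (T := T)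
            (continuousOn_prim (Lp.memLp (c • u)).integrableOn_Ioc)),
          MemLp.coeFn_toLp (memLp_of_continuousOn (T := T) (continuousOn_prim (Lp.memLp u).integrableOn_Ioc)),
          Lp.coeFn_smul c ((memLp_of_continuousOn (T := T)
            (continuousOn_prim (Lp.memLp u).integrableOn_Ioc)).toLp (prim u)),
          ae_restrict_mem measurableSet_Ioo] with s h1 h2 h4 hs
        rw [h1, RingHom.id_apply, h4, Pi.smul_apply, h2,
          prim_congr (Lp.coeFn_smul c u) (Ioo_subset_Icc_self hs)]
        exact intervalIntegral.integral_smul c _ }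
    -- Pointwise `‖prim u s‖² ≤ T ‖u‖²` by Cauchy–Schwarz; integrating over length `T` gives the
    -- operator bound `T`.
    T (by
      intro u
      have hm : (timeMeasure T).real univ = T := by simp [timeMeasure, Measure.real, hT.le]
      refine abs_le_of_sq_le_sq' ?_ (by positivity) |>.2
      rw [norm_sq_Lp_two, mul_pow, norm_sq_Lp_two u]
      have hb : ∀ᵐ s ∂timeMeasure T, ‖(memLp_of_continuousOn (T := T)
          (continuousOn_prim (Lp.memLp u).integrableOn_Ioc)).toLp (prim u) s‖ ^ 2
          ≤ T * ∫ x, ‖u x‖ ^ 2 ∂timeMeasure T := by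
        filter_upwards [MemLp.coeFn_toLp (memLp_of_continuousOn (T := T)
          (continuousOn_prim (Lp.memLp u).integrableOn_Ioc)), ae_restrict_mem measurableSet_Ioo]
          with s h1 hs
        rw [h1]
        calc ‖prim u s‖ ^ 2 ≤ (∫ r, ‖u r‖ ∂timeMeasure T) ^ 2 := by
              gcongr
              exact norm_prim_le (Lp.memLp u).integrableOn_Ioc (Ioo_subset_Icc_self hs)
          _ ≤ _ := by
              have := sq_integral_norm_le (Lp.memLp u)
              rwa [hm] at this
      have := integral_mono_ae ((Lp.memLp _).norm.integrable_sq) (integrable_const _) hb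
      refine this.trans_eq ?_
      rw [integral_const, hm, smul_eq_mul]
      ring)

theorem coeFn_volterra {T : ℝ} (hT : 0 < T) (u : Lp H 2 (timeMeasure T)) :
    ∀ᵐ s ∂timeMeasure T, volterra H hT u s = prim u s :=
  MemLp.coeFn_toLp (memLp_of_continuousOn (continuousOn_prim (Lp.memLp u).integrableOn_Ioc))

theorem DenseRange.adjoint_injective {J : V →L[ℝ] H} (hJ : DenseRange J) {h : H}
    (hh : ContinuousLinearMap.adjoint J h = 0) : h = 0 := by
  refine hJ.induction_on (p := fun x => inner ℝ h x = 0) h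
    (isClosed_eq (by fun_prop) continuous_const) (fun v => ?_) |> inner_self_eq_zero.1
  rw [← ContinuousLinearMap.adjoint_inner_left, hh, inner_zero_left]

theorem compLpL_volterra {T : ℝ} (hT : 0 < T) (S : H →L[ℝ] H) (q : Lp H 2 (timeMeasure T)) :
    S.compLpL 2 (timeMeasure T) (volterra H hT q)
      = volterra H hT (S.compLpL 2 (timeMeasure T) q) := by
  ext1
  filter_upwards [S.coeFn_compLpL (volterra H hT q), coeFn_volterra hT q, coeFn_volterra hT
    (S.compLpL 2 (timeMeasure T) q), ae_restrict_mem measurableSet_Ioo] with s h1 h2 h3 hs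
  rw [h1, h2, h3, map_prim S (Lp.memLp q).integrableOn_Ioc (Ioo_subset_Icc_self hs)]
  exact (prim_congr (S.coeFn_compLpL q) (Ioo_subset_Icc_self hs)).symm

theorem compLpL_constL {T : ℝ} (S : H →L[ℝ] H) (b : H) :
    S.compLpL 2 (timeMeasure T) (Lp.constL 2 (timeMeasure T) ℝ b)
      = Lp.constL 2 (timeMeasure T) ℝ (S b) := by
  ext1
  filter_upwards [S.coeFn_compLpL (Lp.constL 2 (timeMeasure T) ℝ b),
    Lp.coeFn_const (p := 2) (μ := timeMeasure T) b,
    Lp.coeFn_const (p := 2) (μ := timeMeasure T) (S b)] with s h1 h2 h3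
  rw [h1]
  exact (congrArg S h2).trans h3.symm

/-- Moving `J` across as its adjoint `G` leaves `∫ (G q, G b + ∫ G q)`, the integral of a total
derivative. -/
theorem inner_compLpL_volterra_add {T : ℝ} (hT : 0 < T) (J : V →L[ℝ] H)
    (q : Lp H 2 (timeMeasure T)) (b : H) :
    inner ℝ ((J.comp (ContinuousLinearMap.adjoint J)).compLpL 2 (timeMeasure T) q)
      (volterra H hT q + Lp.constL 2 (timeMeasure T) ℝ b)
      = (‖ContinuousLinearMap.adjoint J (b + prim q T)‖ ^ 2
        - ‖ContinuousLinearMap.adjoint J b‖ ^ 2) / 2 := by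
  set G := ContinuousLinearMap.adjoint J with hG
  have hq := (Lp.memLp q).integrableOn_Ioc
  have hGq : IntegrableOn (fun s => G (q s)) (Ioc 0 T) := G.integrable_comp hq
  rw [map_add, map_prim G hq (right_mem_Icc.2 hT.le), ← integral_inner_add_prim hT hGq (G b),
    L2.inner_def, ← integral_Ioo_eq_interval hT]
  refine integral_congr_ae ?_
  filter_upwards [(J.comp G).coeFn_compLpL q, coeFn_volterra hT q,
    Lp.coeFn_add (volterra H hT q) (Lp.constL 2 (timeMeasure T) ℝ b),
    Lp.coeFn_const (p := 2) (μ := timeMeasure T) b,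
    ae_restrict_mem measurableSet_Ioo] with s h1 h2 h3 h4 hs
  have h4' : (Lp.constL 2 (timeMeasure T) ℝ b : Lp H 2 (timeMeasure T)) s = b := h4
  rw [h1, h3, Pi.add_apply, h2, h4', ContinuousLinearMap.comp_apply,
    ← map_prim G hq (Ioo_subset_Icc_self hs), ← map_add, add_comm b, hG,
    ContinuousLinearMap.adjoint_inner_right]

theorem Submodule.eq_top_of_isClosed_of_orthogonal {E : Submodule ℝ V} (hE : IsClosed (E : Set V))
    (h : ∀ v, (∀ e ∈ E, inner ℝ e v = 0) → v = 0) : E = ⊤ := by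
  have : CompleteSpace E := hE.completeSpace_coe
  rw [← Submodule.orthogonal_eq_bot_iff, Submodule.eq_bot_iff]
  exact fun v hv => h v ((Submodule.mem_orthogonal _ _).1 hv)

/-- Regular solutions are explicit: for `p = b + ∫ q` and `u = J G q`, with `G` the adjoint of `J`,
one has `J G p = J G b + ∫ u`. The initial value is then `G b + ζ` with `ζ` in the kernel of `J`,
which need not be trivial here. On the closure `W` of these triples `(u, p, z₀)` the data `(u + p,
z₀)` control `u` and `p`, so the set `D` of attained data is closed; nothing nonzero is orthogonal
to it, so all data are attained. -/
theorem exists_maximal_regularity_Lp {T : ℝ} (hT : 0 < T) {J : V →L[ℝ] H} (hJ : DenseRange J)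
    (h : Lp H 2 (timeMeasure T)) (z₀ : V) : ∃ u p : Lp H 2 (timeMeasure T),
      (J.comp (ContinuousLinearMap.adjoint J)).compLpL 2 (timeMeasure T) p
        = volterra H hT u + Lp.constL 2 (timeMeasure T) ℝ (J z₀) ∧ u + p = h := by
  set G := ContinuousLinearMap.adjoint J with hG
  set S := (J.comp G).compLpL 2 (timeMeasure T) with hS
  set K := volterra H hT
  set c : H →L[ℝ] Lp H 2 (timeMeasure T) := Lp.constL 2 (timeMeasure T) ℝ with hc
  let Ψ : (Lp H 2 (timeMeasure T) × H × J.ker) →ₗ[ℝ]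
      (Lp H 2 (timeMeasure T) × Lp H 2 (timeMeasure T) × V) :=
    { toFun := fun x => (S x.1, K x.1 + c x.2.1, G x.2.1 + (x.2.2 : V))
      map_add' := fun x y => by
        simp only [Prod.fst_add, Prod.snd_add, map_add, Submodule.coe_add, Prod.mk_add_mk,
          Prod.mk.injEq]
        exact ⟨trivial, by abel, by abel⟩
      map_smul' := fun r x => by simp [smul_add] }
  set W := (LinearMap.range Ψ).topologicalClosure with hW
  have hWc : IsClosed (W : Set (Lp H 2 (timeMeasure T) × Lp H 2 (timeMeasure T) × V)) :=
    Submodule.isClosed_topologicalClosure _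
  have hmem (q : Lp H 2 (timeMeasure T)) (b : H) (ζ : V) (hζ : J ζ = 0) :
      ((S q, K q + c b, G b + ζ) : _ × _ × V) ∈ W :=
    Submodule.le_topologicalClosure _ ⟨(q, b, ⟨ζ, hζ⟩), rfl⟩
  -- With `p = b + ∫ q`, the cross term `2 (u, p)` is `‖G p(T)‖² - ‖G b‖²`, and `‖G b‖² ≤ ‖z₀‖²`
  -- because `G b` is orthogonal to the kernel of `J`.
  have hbound : ∀ x ∈ W, ‖x.1‖ ^ 2 + ‖x.2.1‖ ^ 2 ≤ ‖x.1 + x.2.1‖ ^ 2 + ‖x.2.2‖ ^ 2 := by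
    intro x hx
    refine closure_minimal (t := {x | ‖x.1‖ ^ 2 + ‖x.2.1‖ ^ 2 ≤ ‖x.1 + x.2.1‖ ^ 2 + ‖x.2.2‖ ^ 2})
      ?_ (isClosed_le (by fun_prop) (by fun_prop)) hx
    rintro _ ⟨⟨q, b, ζ, hζ⟩, rfl⟩
    change ‖S q‖ ^ 2 + ‖K q + c b‖ ^ 2 ≤ ‖S q + (K q + c b)‖ ^ 2 + ‖G b + ζ‖ ^ 2
    have h1 : inner ℝ (S q) (K q + c b) = (‖G (b + prim q T)‖ ^ 2 - ‖G b‖ ^ 2) / 2 :=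
      inner_compLpL_volterra_add hT J q b
    have h2 : inner ℝ (G b) ζ = 0 := by
      rw [hG, ContinuousLinearMap.adjoint_inner_left, show J ζ = 0 from hζ, inner_zero_right]
    rw [norm_add_sq_real (S q), norm_add_sq_real (G b), h1, h2]
    nlinarith [sq_nonneg ‖G (b + prim q T)‖, sq_nonneg ‖ζ‖]
  have heq : ∀ x ∈ W, S x.2.1 = K x.1 + c (J x.2.2) := by
    intro x hx
    refine closure_minimal (t := {x | S x.2.1 = K x.1 + c (J x.2.2)})
      ?_ (isClosed_eq (by fun_prop) (by fun_prop)) hx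
    rintro _ ⟨⟨q, b, ζ, hζ⟩, rfl⟩
    change S (K q + c b) = K (S q) + c (J (G b + ζ))
    rw [map_add, map_add J, show J ζ = 0 from hζ, add_zero, hS, compLpL_volterra hT,
      hc, compLpL_constL]
    rfl
  let Φ : (Lp H 2 (timeMeasure T) × Lp H 2 (timeMeasure T) × V) →L[ℝ]
      (Lp H 2 (timeMeasure T) × V) :=
    ContinuousLinearMap.prod
      (ContinuousLinearMap.fst ℝ _ (_ × V) + (ContinuousLinearMap.fst ℝ _ V).comp
        (ContinuousLinearMap.snd ℝ _ _))
      ((ContinuousLinearMap.snd ℝ _ V).comp (ContinuousLinearMap.snd ℝ _ _))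
  have : CompleteSpace W := hWc.completeSpace_coe
  set D := LinearMap.range (Φ.comp W.subtypeL).toLinearMap with hD
  have hDc : IsClosed (D : Set (Lp H 2 (timeMeasure T) × V)) := by
    have ha : AntilipschitzWith 2 (Φ.comp W.subtypeL) := by
      refine ContinuousLinearMap.antilipschitz_of_bound _ fun x => ?_
      obtain ⟨x, hx⟩ := x
      have hb := hbound x hx
      change ‖x‖ ≤ 2 * ‖Φ x‖
      set m := ‖Φ x‖ with hm
      have hm0 : 0 ≤ m := norm_nonneg _
      have h1 : ‖x.1 + x.2.1‖ ≤ m := norm_fst_le (Φ x)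
      have h2 : ‖x.2.2‖ ≤ m := norm_snd_le (Φ x)
      have h3 : ‖x.1 + x.2.1‖ ^ 2 ≤ m ^ 2 := pow_le_pow_left₀ (norm_nonneg _) h1 2
      have h4 : ‖x.2.2‖ ^ 2 ≤ m ^ 2 := pow_le_pow_left₀ (norm_nonneg _) h2 2
      refine norm_prod_le_iff.2 ⟨?_, norm_prod_le_iff.2 ⟨?_, by linarith⟩⟩
      · exact (abs_le_of_sq_le_sq' (by nlinarith [sq_nonneg ‖x.2.1‖]) (by positivity)).2
      · exact (abs_le_of_sq_le_sq' (by nlinarith [sq_nonneg ‖x.1‖]) (by positivity)).2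
    exact ha.isClosed_range (Φ.comp W.subtypeL).uniformContinuous
  have hDmem (q : Lp H 2 (timeMeasure T)) (b : H) (ζ : V) (hζ : J ζ = 0) :
      ((S q + (K q + c b), G b + ζ) : _ × V) ∈ D := ⟨⟨_, hmem q b ζ hζ⟩, rfl⟩
  -- Choosing `q = k`, `b = 0` gives `∫ ‖G k‖² + ‖prim k T‖² / 2 = 0`, and `G` is injective because
  -- `J` has dense range.
  have hE₁ : D.comap (LinearMap.inl ℝ _ V) = ⊤ := by
    refine Submodule.eq_top_of_isClosed_of_orthogonal
      (hDc.preimage (ContinuousLinearMap.inl ℝ _ V).continuous) fun k hk => ?_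
    have h1 := hk (S k + K k) (by
      have := hDmem k 0 0 (map_zero J)
      simpa using this)
    have h2 : inner ℝ (S k) k = ∫ s, ‖G (k s)‖ ^ 2 ∂timeMeasure T := by
      rw [L2.inner_def]
      refine integral_congr_ae ?_
      filter_upwards [(J.comp G).coeFn_compLpL k] with s h1
      rw [h1, ContinuousLinearMap.comp_apply, ← ContinuousLinearMap.adjoint_inner_right,
        real_inner_self_eq_norm_sq]
    have h3 : 0 ≤ inner ℝ (K k) k := by
      have hi := integral_inner_add_prim hT (Lp.memLp k).integrableOn_Ioc 0
      rw [← integral_Ioo_eq_interval hT] at hi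
      rw [L2.inner_def]
      have : ∫ s in Ioo 0 T, inner ℝ (K k s) (k s) = ∫ s in Ioo 0 T, inner ℝ (k s) (0 + prim k s) := by
        refine integral_congr_ae ?_
        filter_upwards [coeFn_volterra hT k] with s hs
        rw [hs, zero_add, real_inner_comm]
      rw [this, hi, norm_zero]
      nlinarith [sq_nonneg ‖0 + prim k T‖]
    rw [inner_add_left, h2] at h1
    have h4 : 0 ≤ ∫ s, ‖G (k s)‖ ^ 2 ∂timeMeasure T := integral_nonneg fun s => sq_nonneg _
    have h5 : ∫ s, ‖G (k s)‖ ^ 2 ∂timeMeasure T = 0 := by linarith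
    have h6 : Integrable (fun s => ‖G (k s)‖ ^ 2) (timeMeasure T) :=
      (G.comp_memLp' (Lp.memLp k)).norm.integrable_sq
    rw [integral_eq_zero_iff_of_nonneg (fun s => sq_nonneg _) h6] at h5
    rw [Lp.eq_zero_iff_ae_eq_zero]
    filter_upwards [h5] with s hs
    exact DenseRange.adjoint_injective hJ (by simpa using hs)
  -- The first coordinate can now be cancelled, so `v` is orthogonal to every `G b` and `J v = 0`;
  -- hence `ζ = v` is admissible and forces `v = 0`.
  have hE₂ : D.comap (LinearMap.inr ℝ (Lp H 2 (timeMeasure T)) V) = ⊤ := by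
    refine Submodule.eq_top_of_isClosed_of_orthogonal
      (hDc.preimage (ContinuousLinearMap.inr ℝ _ V).continuous) fun v hv => ?_
    have hb (b : H) : inner ℝ (G b) v = 0 := by
      refine hv _ ?_
      have h1 := hDmem 0 b 0 (map_zero J)
      have h2 : c b ∈ D.comap (LinearMap.inl ℝ _ V) := by rw [hE₁]; trivial
      have := D.sub_mem h1 h2
      simpa using this
    have hv0 : J v = 0 := by
      have := hb (J v)
      rwa [hG, ContinuousLinearMap.adjoint_inner_left, inner_self_eq_zero] at this
    have := hv v (by simpa using hDmem 0 0 v hv0)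
    exact inner_self_eq_zero.1 this
  have hfin : ((h, z₀) : _ × V) ∈ D := by
    have h1 : h ∈ D.comap (LinearMap.inl ℝ _ V) := by rw [hE₁]; trivial
    have h2 : z₀ ∈ D.comap (LinearMap.inr ℝ (Lp H 2 (timeMeasure T)) V) := by rw [hE₂]; trivial
    have := D.add_mem h1 h2
    simpa using this
  obtain ⟨⟨x, hx⟩, hxe⟩ := hfin
  have hx1 : x.1 + x.2.1 = h := congrArg Prod.fst hxe
  have hx2 : x.2.2 = z₀ := congrArg Prod.snd hxe
  refine ⟨x.1, x.2.1, ?_, hx1⟩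
  rw [← hx2]
  exact heq x hx

/-- Solvability of `u + p = h`, where `z = z₀ + ∫ u = J J† p`: for the operator `B` with inverse
`J J†` this is the equation `z' + B z = h`, `z(0) = z₀`, with `z'` and `B z` in `L²(0, T; H)`. -/
theorem exists_maximal_regularity {T : ℝ} (hT : 0 < T) {J : V →L[ℝ] H} (hJ : DenseRange J)
    {h : ℝ → H} (hh : MemLp h 2 (timeMeasure T)) (z₀ : V) : ∃ u p : ℝ → H,
      MemLp u 2 (timeMeasure T) ∧ MemLp p 2 (timeMeasure T) ∧
      ∀ᵐ s ∂timeMeasure T, J (ContinuousLinearMap.adjoint J (p s)) = J z₀ + prim u s ∧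
        u s + p s = h s := by
  obtain ⟨u, p, h1, h2⟩ := exists_maximal_regularity_Lp hT hJ (hh.toLp h) z₀
  refine ⟨u, p, Lp.memLp u, Lp.memLp p, ?_⟩
  have h1' := congrArg (fun w : Lp H 2 (timeMeasure T) => (w : ℝ → H)) h1
  have h2' := congrArg (fun w : Lp H 2 (timeMeasure T) => (w : ℝ → H)) h2
  filter_upwards [hh.coeFn_toLp, Lp.coeFn_add u p, coeFn_volterra hT u,
    (J.comp (ContinuousLinearMap.adjoint J)).coeFn_compLpL p,
    Lp.coeFn_add (volterra H hT u) (Lp.constL 2 (timeMeasure T) ℝ (J z₀)),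
    Lp.coeFn_const (p := 2) (μ := timeMeasure T) (J z₀)] with s a1 a2 a3 a4 a5 a6
  have a6' : (Lp.constL 2 (timeMeasure T) ℝ (J z₀) : Lp H 2 (timeMeasure T)) s = J z₀ := a6
  constructor
  · rw [← ContinuousLinearMap.comp_apply, ← a4, congrFun h1' s, a5, Pi.add_apply, a3, a6', add_comm]
  · rw [← Pi.add_apply, ← a2, congrFun h2' s, a1]

end MaximalRegularity

/-! ### Density and duality pairings in Hilbert spaces. -/

section HilbertSpaces

variable {H V : Type*} [NormedAddCommGroup H] [InnerProductSpace ℝ H] [CompleteSpace H]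
  [NormedAddCommGroup V] [InnerProductSpace ℝ V] [CompleteSpace V]

/-- The operator `w ↦ (v ↦ (w, G v))`. -/
noncomputable def innerComp (G : V →L[ℝ] H) : H →L[ℝ] V →L[ℝ] ℝ :=
  ((ContinuousLinearMap.compL ℝ V H ℝ).flip G).comp (innerSL ℝ : H →L[ℝ] H →L[ℝ] ℝ)

theorem innerComp_apply (G : V →L[ℝ] H) (w : H) (v : V) : innerComp G w v = inner ℝ w (G v) := rfl

theorem denseRange_of_orthogonal {J : V →L[ℝ] H} (h : ∀ w, (∀ v, inner ℝ (J v) w = 0) → w = 0) :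
    DenseRange J := by
  have h1 : J.range.topologicalClosure = ⊤ :=
    Submodule.eq_top_of_isClosed_of_orthogonal (Submodule.isClosed_topologicalClosure _)
      fun w hw => h w fun v => hw (J v) (Submodule.le_topologicalClosure _ ⟨v, rfl⟩)
  have h2 := congrArg (fun S : Submodule ℝ H => (S : Set H)) h1
  rw [DenseRange, dense_iff_closure_eq]
  exact h2

theorem integrable_pairing {α E F : Type*} [MeasurableSpace α] {μ : Measure α}
    [NormedAddCommGroup E] [NormedSpace ℝ E] [NormedAddCommGroup F] [NormedSpace ℝ F]
    {g : α → E →L[ℝ] F} {v : α → E} (hg : MemLp g 2 μ) (hv : MemLp v 2 μ) :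
    Integrable (fun s => g s (v s)) μ := by
  refine Integrable.mono' (hg.norm.integrable_mul hv.norm) ?_ (ae_of_all _ fun s => ?_)
  · exact (ContinuousLinearMap.apply ℝ F).flip.aestronglyMeasurable_comp₂ hg.1 hv.1
  · exact (g s).le_opNorm _

/-- Testing with the pointwise Riesz representative of `g` turns the pairing into `∫ ‖g‖²`. -/
theorem ae_eq_zero_of_integral_pairing {α V : Type*} [MeasurableSpace α] {μ : Measure α}
    [NormedAddCommGroup V] [InnerProductSpace ℝ V] [CompleteSpace V]
    {g : α → V →L[ℝ] ℝ} (hg : MemLp g 2 μ)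
    (h : ∀ v : α → V, MemLp v 2 μ → ∫ s, g s (v s) ∂μ = 0) : g =ᵐ[μ] 0 := by
  set R := (InnerProductSpace.toDual ℝ V).symm
  have hv : MemLp (fun s => R (g s)) 2 μ :=
    hg.congr_norm (R.continuous.comp_aestronglyMeasurable hg.1)
      (ae_of_all _ fun s => (R.norm_map (g s)).symm)
  have h1 := h _ hv
  have h2 (s : α) : g s (R (g s)) = ‖R (g s)‖ ^ 2 := by
    rw [← real_inner_self_eq_norm_sq]
    exact (InnerProductSpace.toDual_symm_apply).symm
  simp_rw [h2] at h1
  rw [integral_eq_zero_iff_of_nonneg (fun s => sq_nonneg _) hv.norm.integrable_sq] at h1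
  filter_upwards [h1] with s hs
  simpa using hs

end HilbertSpaces

/-! ### The inner product of `H¹₀(Ω)` and its density in `L²(Ω)`. -/

section Spaces

variable {n : ℕ} {Ω : Set (Space n)}

theorem inner_H10 (u v : H10 Ω) :
    inner ℝ u v = inner ℝ (toL2 Ω u) (toL2 Ω v) + dirichlet u v := by
  rw [Submodule.coe_inner, WithLp.prod_inner_apply]
  rfl

theorem exists_testFun_mem (φ : Space n → ℝ) (hφ : IsTestFun Ω φ) : ∃ v : H10 Ω,
    (toL2 Ω v : Space n → ℝ) =ᵐ[volume.restrict Ω] φ ∧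
    (grad Ω v : Space n → Space n) =ᵐ[volume.restrict Ω] ∇ φ := by
  have h1 : MemLp φ 2 (volume.restrict Ω) :=
    (hφ.smooth.continuous.memLp_of_hasCompactSupport hφ.compact).restrict _
  have hgc : Continuous (∇ φ) := by
    have : Continuous (fderiv ℝ φ) := hφ.smooth.continuous_fderiv (by simp)
    exact (InnerProductSpace.toDual ℝ (Space n)).symm.continuous.comp this
  have hgs : HasCompactSupport (∇ φ) := by
    refine (hφ.compact.fderiv ℝ).comp_left (g := (InnerProductSpace.toDual ℝ (Space n)).symm) ?_
    simp
  have h2 : MemLp (∇ φ) 2 (volume.restrict Ω) := (hgc.memLp_of_hasCompactSupport hgs).restrict _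
  let p : WithLp 2 (L2 Ω × L2Vec Ω) := WithLp.toLp 2 (h1.toLp φ, h2.toLp (∇ φ))
  have hp : p ∈ testPairs Ω := ⟨φ, hφ, h1.coeFn_toLp, h2.coeFn_toLp⟩
  exact ⟨⟨p, Submodule.le_topologicalClosure _ (Submodule.subset_span hp)⟩,
    h1.coeFn_toLp, h2.coeFn_toLp⟩

/-- Anything orthogonal to the range is orthogonal to all test functions, hence zero almost
everywhere on the open set `Ω`. -/
theorem denseRange_toL2 (hΩ : IsOpen Ω) : DenseRange (toL2 Ω) := by
  refine denseRange_of_orthogonal fun w hw => ?_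
  have h : ∀ᵐ x ∂volume, x ∈ Ω → w x = 0 := by
    refine hΩ.ae_eq_zero_of_integral_contDiff_smul_eq_zero ?_ fun φ hφ hc hs => ?_
    · rw [locallyIntegrableOn_iff hΩ.isLocallyClosed]
      intro K hK hKc
      have h1 : MemLp w 2 (volume.restrict K) :=
        (Lp.memLp w).mono_measure (Measure.restrict_mono hK le_rfl)
      have : IsFiniteMeasure (volume.restrict K) := ⟨by simpa using hKc.measure_lt_top⟩
      exact h1.integrable (by norm_num)
    · obtain ⟨v, hv, -⟩ := exists_testFun_mem φ ⟨hφ, hc, hs⟩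
      have h1 := hw v
      rw [L2.inner_def] at h1
      rw [← h1, ← setIntegral_eq_integral_of_forall_compl_eq_zero (s := Ω)]
      · refine integral_congr_ae ?_
        filter_upwards [hv] with x hx
        simp [hx, mul_comm]
      · intro x hx
        rw [image_eq_zero_of_notMem_tsupport fun h => hx (hs h), zero_smul]
  rw [Lp.eq_zero_iff_ae_eq_zero]
  exact (ae_restrict_iff' hΩ.measurableSet).2 h

end Spaces

/-! ### Uniqueness and parabolic regularity. -/

section Regularity

variable {H V E : Type*} [NormedAddCommGroup H] [InnerProductSpace ℝ H] [CompleteSpace H]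
  [NormedAddCommGroup V] [InnerProductSpace ℝ V] [CompleteSpace V]
  [NormedAddCommGroup E] [InnerProductSpace ℝ E] [CompleteSpace E]
  {J : V →L[ℝ] H} {D : V →L[ℝ] E}

theorem memLp_add {X : Type*} [NormedAddCommGroup X] {α : Type*} [MeasurableSpace α]
    {μ : Measure α} {u v : α → X} (hu : MemLp u 2 μ) (hv : MemLp v 2 μ) :
    MemLp (fun s => u s + v s) 2 μ := hu.add hv

/-- Uniqueness for the time-integrated homogeneous heat equation. -/
theorem ae_eq_zero_of_integrated_heat
    (hV : ∀ u v : V, inner ℝ u v = inner ℝ (J u) (J v) + inner ℝ (D u) (D v))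
    {T : ℝ} (hT : 0 < T) {δ : ℝ → V} (hδ : MemLp δ 2 (timeMeasure T))
    (h : ∀ᵐ s ∂timeMeasure T, ∀ v, inner ℝ (J (δ s)) (J v) + inner ℝ (D (prim δ s)) (D v) = 0) :
    ∀ᵐ s ∂timeMeasure T, δ s = 0 := by
  have hi := hδ.integrableOn_Ioc
  have hgi : IntegrableOn (fun s => D (δ s)) (Ioc 0 T) := D.integrable_comp hi
  have h1 := integral_inner_add_prim hT hgi 0
  rw [← integral_Ioo_eq_interval hT, norm_zero] at h1
  -- Testing with `δ s` itself: the left side integrates to half a square, the right side is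
  -- nonpositive, so `J δ = 0`.
  have h2 : ∫ s in Ioo 0 T, inner ℝ (D (δ s)) (0 + prim (fun s => D (δ s)) s)
      = ∫ s in Ioo 0 T, -(‖J (δ s)‖ ^ 2) := by
    refine integral_congr_ae ?_
    filter_upwards [h, ae_restrict_mem measurableSet_Ioo] with s hs hsT
    have h3 := hs (δ s)
    rw [real_inner_self_eq_norm_sq] at h3
    rw [zero_add, ← map_prim D hi (Ioo_subset_Icc_self hsT), real_inner_comm]
    linarith
  have hJ : MemLp (fun s => J (δ s)) 2 (timeMeasure T) := J.comp_memLp' hδ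
  have h4 : ∫ s in Ioo 0 T, ‖J (δ s)‖ ^ 2 = 0 := by
    rw [h2, integral_neg] at h1
    refine le_antisymm ?_ (integral_nonneg fun s => sq_nonneg _)
    nlinarith [sq_nonneg ‖0 + prim (fun s => D (δ s)) T‖]
  rw [integral_eq_zero_iff_of_nonneg (fun s => sq_nonneg _) hJ.norm.integrable_sq] at h4
  have h5 : ∀ᵐ s ∂timeMeasure T, J (δ s) = 0 := by
    filter_upwards [h4] with s hs
    simpa using hs
  -- Once `J δ = 0`, testing with `prim δ s` kills its gradient as well, so it vanishes in `V` even
  -- if `J` is not injective.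
  have h6 : ∀ᵐ s ∂timeMeasure T, prim δ s = 0 := by
    filter_upwards [h, h5, ae_restrict_mem measurableSet_Ioo] with s hs h5s hsT
    have h7 : J (prim δ s) = 0 := by
      rw [map_prim J hi (Ioo_subset_Icc_self hsT),
        prim_congr (v := fun _ => 0) h5 (Ioo_subset_Icc_self hsT), prim]
      simp
    have h8 := hs (prim δ s)
    rw [h5s, inner_zero_left, zero_add] at h8
    rw [← inner_self_eq_zero (𝕜 := ℝ), hV, h7, h8, inner_zero_left, zero_add]
  refine ae_eq_zero_of_prim_eq_zero hT hi fun s hs => ?_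
  exact eq_of_ae_eq_of_continuousOn hT (continuousOn_prim hi) continuousOn_const h6 hs

theorem ae_eq_of_weak_formulation {T : ℝ} {f y' : ℝ → V →L[ℝ] ℝ} {y : ℝ → V}
    (hf : MemLp f 2 (timeMeasure T)) (hy : MemLp y 2 (timeMeasure T))
    (hy' : MemLp y' 2 (timeMeasure T))
    (h : ∀ v : ℝ → V, MemLp v 2 (timeMeasure T) →
      ∫ s in Ioo 0 T, (y' s (v s) + inner ℝ (D (y s)) (D (v s))) = ∫ s in Ioo 0 T, f s (v s)) :
    ∀ᵐ s ∂timeMeasure T, y' s + innerComp D (D (y s)) = f s := by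
  have hA : MemLp (fun s => innerComp D (D (y s))) 2 (timeMeasure T) :=
    ((innerComp D).comp D).comp_memLp' hy
  have hs : MemLp (fun s => y' s + innerComp D (D (y s))) 2 (timeMeasure T) := memLp_add hy' hA
  have h1 := ae_eq_zero_of_integral_pairing (g := fun s => y' s + innerComp D (D (y s)) - f s)
    (hs.sub hf) fun v hv => by
      have h2 := h v hv
      have h3 : (fun s => (y' s + innerComp D (D (y s)) - f s) (v s))
          = fun s => (y' s + innerComp D (D (y s))) (v s) - f s (v s) := by ext s; rfl
      rw [h3, integral_sub (integrable_pairing hs hv) (integrable_pairing hf hv), sub_eq_zero]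
      exact h2
  filter_upwards [h1] with s hs
  exact sub_eq_zero.1 hs

theorem innerComp_eq_add_prim {T : ℝ} (hT : 0 < T) {y' : ℝ → V →L[ℝ] ℝ} {y : ℝ → V} {w : ℝ → H}
    (hy' : MemLp y' 2 (timeMeasure T))
    (hd : HasWeakTimeDeriv T (fun s => innerComp J (J (y s))) y') (hw : ContinuousOn w (Icc 0 T))
    (hyw : (fun s => J (y s)) =ᵐ[timeMeasure T] w) {s : ℝ} (hs : s ∈ Icc 0 T) :
    innerComp J (w s) = innerComp J (w 0) + prim y' s := by
  refine eq_add_prim_of_hasInitialValue hT (w := fun s => innerComp J (w s))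
    ((innerComp J).continuous.comp_continuousOn hw) ?_ hy'.integrableOn_Ioc hd hs
  filter_upwards [hyw] with s hs
  rw [← hs]

/-- The product rule for `exp s • (b + ∫ u)` in integrated form; it undoes the exponential weight
that turns `-Δ` into `1 - Δ`. -/
theorem exp_smul_add_prim {X : Type*} [NormedAddCommGroup X] [NormedSpace ℝ X] [CompleteSpace X]
    {T : ℝ} {u : ℝ → X} (hu : IntegrableOn u (Ioc 0 T)) (b : X) {s : ℝ} (hs : s ∈ Icc 0 T) :
    Real.exp s • (b + prim u s)
      = b + prim (fun r => Real.exp r • u r + Real.exp r • (b + prim u r)) s := by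
  have hus : IntegrableOn u (Ioc 0 s) := hu.mono_set (Ioc_subset_Ioc_right hs.2)
  have hui : IntervalIntegrable u volume 0 s :=
    (intervalIntegrable_iff_integrableOn_Ioc_of_le hs.1).2 hus
  have h1 := integral_bilin_primitive (ContinuousLinearMap.lsmul ℝ ℝ) hs.1
    (Real.continuous_exp.integrableOn_Ioc (μ := volume)) hus
  simp only [ContinuousLinearMap.lsmul_apply, integral_exp, Real.exp_zero] at h1
  change ∫ r in (0 : ℝ)..s, Real.exp r • prim u r = (Real.exp s - 1) • prim u s - _ at h1
  have hcont : ContinuousOn (fun r => Real.exp r • prim u r) (uIcc 0 s) := by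
    rw [uIcc_of_le hs.1]
    exact Real.continuous_exp.continuousOn.smul (continuousOn_prim hus)
  have heu : IntervalIntegrable (fun r => Real.exp r • u r) volume 0 s :=
    hui.continuousOn_smul Real.continuous_exp.continuousOn
  have heb : IntervalIntegrable (fun r => Real.exp r • b) volume 0 s :=
    (Real.continuous_exp.smul continuous_const).intervalIntegrable _ _
  have h2 : ∫ r in (0 : ℝ)..s, (Real.exp r - 1) • u r
      = (∫ r in (0 : ℝ)..s, Real.exp r • u r) - prim u s := by
    simp_rw [sub_smul, one_smul]
    exact intervalIntegral.integral_sub heu hui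
  have h3 : prim (fun r => Real.exp r • u r + Real.exp r • (b + prim u r)) s
      = (∫ r in (0 : ℝ)..s, Real.exp r • u r) + ((∫ r in (0 : ℝ)..s, Real.exp r • b)
        + ∫ r in (0 : ℝ)..s, Real.exp r • prim u r) := by
    rw [prim, ← intervalIntegral.integral_add heb hcont.intervalIntegrable,
      ← intervalIntegral.integral_add heu (heb.add hcont.intervalIntegrable)]
    simp_rw [smul_add]
  rw [h3, h1, h2, intervalIntegral.integral_smul_const, integral_exp, Real.exp_zero]
  module


theorem memLp_exp_smul {X : Type*} [NormedAddCommGroup X] [NormedSpace ℝ X] {T c : ℝ} {u : ℝ → X}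
    (hu : MemLp u 2 (timeMeasure T)) :
    MemLp (fun s => Real.exp (c * s) • u s) 2 (timeMeasure T) := by
  have hc : Continuous fun s : ℝ => Real.exp (c * s) := by fun_prop
  obtain ⟨C, hC⟩ := isCompact_Icc.exists_bound_of_continuousOn (hc.continuousOn (s := Icc 0 T))
  refine hu.of_le_mul (c := C) (hc.aestronglyMeasurable.smul hu.1) ?_
  filter_upwards [ae_restrict_mem measurableSet_Ioo] with s hs
  rw [norm_smul]
  exact mul_le_mul_of_nonneg_right (hC s (Ioo_subset_Icc_self hs)) (norm_nonneg _)

/-- Parabolic regularity for compatible data. -/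
theorem exists_regularity
    (hV : ∀ u v : V, inner ℝ u v = inner ℝ (J u) (J v) + inner ℝ (D u) (D v))
    (hJ : DenseRange J) {T : ℝ} (hT : 0 < T) {f y' : ℝ → V →L[ℝ] ℝ} {y : ℝ → V} {w : ℝ → H}
    (hf : MemLp f 2 (timeMeasure T)) (hy : MemLp y 2 (timeMeasure T))
    (hy' : MemLp y' 2 (timeMeasure T))
    (hd : HasWeakTimeDeriv T (fun s => innerComp J (J (y s))) y') (hw : ContinuousOn w (Icc 0 T))
    (hyw : (fun s => J (y s)) =ᵐ[timeMeasure T] w)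
    (h : ∀ v : ℝ → V, MemLp v 2 (timeMeasure T) →
      ∫ s in Ioo 0 T, (y' s (v s) + inner ℝ (D (y s)) (D (v s))) = ∫ s in Ioo 0 T, f s (v s))
    {F F' : ℝ → H} {g κ₀ η : V} (hF' : MemLp F' 2 (timeMeasure T))
    (hfF : ∀ᵐ s ∂timeMeasure T, f s = innerComp J (F s))
    (hFF' : ∀ᵐ s ∂timeMeasure T, F s = J g + prim F' s)
    (hκ : w 0 = J κ₀) (hη : ∀ v, -inner ℝ (D κ₀) (D v) = inner ℝ (J η) (J v)) :
    ∃ z z' : ℝ → H, MemLp z 2 (timeMeasure T) ∧ MemLp z' 2 (timeMeasure T) ∧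
      (∀ᵐ s ∂timeMeasure T, J (y s) = J κ₀ + prim z s) ∧
      (∀ᵐ s ∂timeMeasure T, z s = J (g + η) + prim z' s) ∧
      ∀ᵐ s ∂timeMeasure T, ∀ v, -inner ℝ (D (y s)) (D v) = inner ℝ (z s - F s) (J v) := by
  have hη' : innerComp D (D κ₀) = -innerComp J (J η) := by
    ext v
    have := hη v
    simp only [innerComp_apply, neg_apply]
    linarith
  -- The adjoint refers to the full inner product of `V`, so `J J†` inverts `1 - Δ`. Maximal
  -- regularity is therefore applied to `exp (-s) z`, where `z` is the expected `∂ₜy`; the initial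
  -- value `g + η` is `f(0) + Δκ`.
  obtain ⟨u, p, hu, hp, hup⟩ := exists_maximal_regularity hT hJ (memLp_exp_smul (c := -1) hF') (g + η)
  set G := ContinuousLinearMap.adjoint J with hG
  set b := J (g + η) with hb
  set zV : ℝ → V := fun s => Real.exp s • G (p s) with hzV
  have hzVm : MemLp zV 2 (timeMeasure T) := by
    simpa using memLp_exp_smul (c := 1) (G.comp_memLp' hp)
  set z : ℝ → H := fun s => Real.exp s • (b + prim u s) with hz
  have hui := hu.integrableOn_Ioc
  have hzc : ContinuousOn z (Icc 0 T) :=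
    Real.continuous_exp.continuousOn.smul (continuousOn_const.add (continuousOn_prim hui))
  have hzm : MemLp z 2 (timeMeasure T) := memLp_of_continuousOn hzc
  set z' : ℝ → H := fun s => Real.exp s • u s + z s with hz'
  have hz'm : MemLp z' 2 (timeMeasure T) := by
    have := memLp_exp_smul (c := 1) hu
    simp only [one_mul] at this
    exact memLp_add this hzm
  have hzz' : ∀ s ∈ Icc 0 T, z s = b + prim z' s := fun s hs => exp_smul_add_prim hui b hs
  have hJz : ∀ᵐ s ∂timeMeasure T, J (zV s) = z s := by
    filter_upwards [hup] with s hs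
    rw [hzV, hz, map_smul, hs.1]
  -- The candidate for `y`: the primitive of the `V`-valued representative of `z`.
  set Y : ℝ → V := fun s => κ₀ + prim zV s with hY
  have hYm : MemLp Y 2 (timeMeasure T) :=
    memLp_of_continuousOn (continuousOn_const.add (continuousOn_prim hzVm.integrableOn_Ioc))
  have hdual : ∀ᵐ s ∂timeMeasure T,
      innerComp J (z' s) = innerComp J (F' s) - innerComp D (D (zV s)) := by
    filter_upwards [hup, hJz] with s hs hJs
    ext v
    have h1 : Real.exp s • u s = F' s - Real.exp s • p s := by
      rw [eq_sub_iff_add_eq, ← smul_add, hs.2, smul_smul, ← Real.exp_add]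
      simp
    have h2 : inner ℝ (Real.exp s • p s) (J v) = inner ℝ (z s) (J v) + inner ℝ (D (zV s)) (D v) := by
      rw [← hJs, ← hV, hzV, inner_smul_left, inner_smul_left, hG,
        ContinuousLinearMap.adjoint_inner_left]
    change inner ℝ (Real.exp s • u s + z s) (J v) = inner ℝ (F' s) (J v) - inner ℝ (D (zV s)) (D v)
    rw [h1, inner_add_left, inner_sub_left, h2]
    ring
  -- The equation for `z` integrated in time. The constants match because `η` is the Laplacian of
  -- `κ₀`, and what remains is the heat equation for `Y`.
  have hzF : ∀ᵐ s ∂timeMeasure T,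
      innerComp J (z s) + innerComp D (D (Y s)) = innerComp J (F s) := by
    filter_upwards [hFF', ae_restrict_mem measurableSet_Ioo] with s hFs hsT
    have hs := Ioo_subset_Icc_self hsT
    have h1 : innerComp J (prim z' s)
        = innerComp J (prim F' s) - innerComp D (D (prim zV s)) := by
      rw [map_prim _ hz'm.integrableOn_Ioc hs, map_prim _ hF'.integrableOn_Ioc hs,
        map_prim D hzVm.integrableOn_Ioc hs,
        map_prim _ (D.integrable_comp hzVm.integrableOn_Ioc) hs, prim_congr hdual hs]
      exact prim_sub ((innerComp J).integrable_comp hF'.integrableOn_Ioc)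
        (((innerComp D).comp D).integrable_comp hzVm.integrableOn_Ioc) hs
    rw [hzz' s hs, hFs, hY, hb]
    simp only [map_add, h1, hη']
    abel
  have hy'eq := ae_eq_of_weak_formulation hf hy hy' h
  have hδm : MemLp (fun s => y s - Y s) 2 (timeMeasure T) := hy.sub hYm
  have hδ : ∀ᵐ s ∂timeMeasure T, y s - Y s = 0 := by
    refine ae_eq_zero_of_integrated_heat hV hT (δ := fun s => y s - Y s) hδm ?_
    have h1 : ∀ᵐ s ∂timeMeasure T,
        y' s = innerComp J (z s) - ((innerComp D).comp D) (y s - Y s) := by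
      filter_upwards [hy'eq, hzF, hfF] with s a1 a2 a3
      rw [ContinuousLinearMap.comp_apply, map_sub, map_sub]
      rw [a3, ← a2] at a1
      rw [eq_sub_of_add_eq a1]
      abel
    filter_upwards [hyw, ae_restrict_mem measurableSet_Ioo] with s hws hsT v
    have hs := Ioo_subset_Icc_self hsT
    have h2 := innerComp_eq_add_prim hT hy' hd hw hyw hs
    have h3 : prim y' s = innerComp J (prim z s)
        - ((innerComp D).comp D) (prim (fun s => y s - Y s) s) := by
      rw [prim_congr h1 hs, map_prim _ hzm.integrableOn_Ioc hs,
        map_prim _ hδm.integrableOn_Ioc hs]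
      exact prim_sub ((innerComp J).integrable_comp hzm.integrableOn_Ioc)
        (((innerComp D).comp D).integrable_comp hδm.integrableOn_Ioc) hs
    have h4 : J (Y s) = J κ₀ + prim z s := by
      rw [hY, map_add, map_prim J hzVm.integrableOn_Ioc hs, prim_congr hJz hs]
    rw [h3] at h2
    have h5 := congrArg (fun L : V →L[ℝ] ℝ => L v) h2
    simp only [innerComp_apply, add_apply, sub_apply,
      ContinuousLinearMap.comp_apply] at h5
    rw [map_sub, h4, inner_sub_left, inner_add_left, hws, h5, hκ]
    ring
  refine ⟨z, z', hzm, hz'm, ?_, ?_, ?_⟩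
  · filter_upwards [hδ, ae_restrict_mem measurableSet_Ioo] with s hs hsT
    have hs' := Ioo_subset_Icc_self hsT
    rw [sub_eq_zero.1 hs, hY, map_add, map_prim J hzVm.integrableOn_Ioc hs', prim_congr hJz hs']
  · filter_upwards [ae_restrict_mem measurableSet_Ioo] with s hsT
    exact hzz' s (Ioo_subset_Icc_self hsT)
  · filter_upwards [hδ, hzF] with s hs hzs v
    have h1 := congrArg (fun L : V →L[ℝ] ℝ => L v) hzs
    simp only [innerComp_apply, add_apply] at h1
    rw [sub_eq_zero.1 hs, inner_sub_left]
    linarith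

end Regularity

/-! ### Partitions, step functions and piecewise affine functions. -/

section Partition

theorem IsPartition.mono {T : ℝ} {M : ℕ} {t : ℕ → ℝ} (ht : IsPartition T M t) {i j : ℕ}
    (hij : i ≤ j) (hj : j ≤ M) : t i ≤ t j := by
  induction j, hij using Nat.le_induction with
  | base => exact le_rfl
  | succ j hij ih => exact (ih (by omega)).trans (ht.lt j (by omega)).le

theorem IsPartition.mem_Icc {T : ℝ} {M : ℕ} {t : ℕ → ℝ} (ht : IsPartition T M t) {i : ℕ}
    (hi : i ≤ M) : t i ∈ Icc 0 T :=
  ⟨ht.zero ▸ ht.mono (Nat.zero_le i) hi, ht.last ▸ ht.mono hi le_rfl⟩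

theorem IsPartition.Ioc_subset {T : ℝ} {M : ℕ} {t : ℕ → ℝ} (ht : IsPartition T M t) {m : ℕ}
    (hm : m < M) : Ioc (t m) (t (m + 1)) ⊆ Ioc 0 T :=
  Ioc_subset_Ioc (ht.mem_Icc hm.le).1 (ht.mem_Icc hm).2

theorem IsPartition.exists_mem_Ico {T : ℝ} {M : ℕ} {t : ℕ → ℝ} (ht : IsPartition T M t) {s : ℝ}
    (hs : s ∈ Ico 0 T) : ∃ m < M, s ∈ Ico (t m) (t (m + 1)) := by
  have h : ∀ j ≤ M, s < t j → ∃ m < j, s ∈ Ico (t m) (t (m + 1)) := by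
    intro j
    induction j with
    | zero => exact fun _ h => absurd hs.1 (not_le.2 (ht.zero ▸ h))
    | succ j ih =>
      intro hj hsj
      rcases lt_or_ge s (t j) with h | h
      · obtain ⟨m, hm, hsm⟩ := ih (by omega) h
        exact ⟨m, by omega, hsm⟩
      · exact ⟨j, by omega, h, hsj⟩
  exact h M le_rfl (ht.last.symm ▸ hs.2)

variable {X : Type*} [NormedAddCommGroup X] [NormedSpace ℝ X]

theorem IsPartition.sum_integral {T : ℝ} {M : ℕ} {t : ℕ → ℝ} (ht : IsPartition T M t)
    {u : ℝ → X} (hu : IntegrableOn u (Ioc 0 T)) :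
    ∑ m ∈ Finset.range M, ∫ s in (t m)..(t (m + 1)), u s = ∫ s in (0 : ℝ)..T, u s := by
  rw [intervalIntegral.sum_integral_adjacent_intervals, ht.zero, ht.last]
  intro m hm
  exact (intervalIntegrable_iff_integrableOn_Ioc_of_le (ht.lt m hm).le).2
    (hu.mono_set (ht.Ioc_subset hm))

/-- The step function with value `d m` on `[t m, t (m + 1))`. -/
noncomputable def stepFun (M : ℕ) (t : ℕ → ℝ) (d : ℕ → X) (s : ℝ) : X :=
  ∑ m ∈ Finset.range M, (Ico (t m) (t (m + 1))).indicator (fun _ => d m) s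

/-- The slopes of the piecewise affine interpolation of the nodal values `V m` at `t m`. -/
noncomputable def slopes (t : ℕ → ℝ) (V : ℕ → X) (m : ℕ) : X :=
  (t (m + 1) - t m)⁻¹ • (V (m + 1) - V m)

/-- The continuous piecewise affine function with nodal values `V m` at `t m`. -/
noncomputable def pwAffine (M : ℕ) (t : ℕ → ℝ) (V : ℕ → X) (s : ℝ) : X :=
  V 0 + prim (stepFun M t (slopes t V)) s

theorem stepFun_apply {T : ℝ} {M : ℕ} {t : ℕ → ℝ} (ht : IsPartition T M t) (d : ℕ → X) {m : ℕ}
    (hm : m < M) {s : ℝ} (hs : s ∈ Ico (t m) (t (m + 1))) : stepFun M t d s = d m := by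
  rw [stepFun, Finset.sum_eq_single m]
  · rw [indicator_of_mem hs]
  · intro j hj hjm
    rw [indicator_of_notMem]
    intro hsj
    rw [Finset.mem_range] at hj
    rcases lt_or_gt_of_ne hjm with h | h
    · exact absurd (hsj.2.trans_le (ht.mono (Nat.succ_le_of_lt h) hm.le)) (not_lt.2 hs.1)
    · exact absurd (hs.2.trans_le (ht.mono (Nat.succ_le_of_lt h) hj.le)) (not_lt.2 hsj.1)
  · exact fun h => absurd (Finset.mem_range.2 hm) h

theorem memLp_stepFun (T : ℝ) (M : ℕ) (t : ℕ → ℝ) (d : ℕ → X) :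
    MemLp (stepFun M t d) 2 (timeMeasure T) :=
  memLp_finsetSum _ fun m _ => (memLp_const (d m)).indicator measurableSet_Ico

theorem integral_congr_Ico {a b : ℝ} (hab : a ≤ b) {u v : ℝ → X} (h : ∀ s ∈ Ico a b, u s = v s) :
    ∫ s in a..b, u s = ∫ s in a..b, v s := by
  rw [intervalIntegral.integral_of_le hab, intervalIntegral.integral_of_le hab,
    integral_Ioc_eq_integral_Ioo, integral_Ioc_eq_integral_Ioo]
  exact setIntegral_congr_fun measurableSet_Ioo fun s hs => h s (Ioo_subset_Ico_self hs)

variable [CompleteSpace X]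

theorem prim_stepFun_sub {T : ℝ} {M : ℕ} {t : ℕ → ℝ} (ht : IsPartition T M t) (d : ℕ → X) {m : ℕ}
    (hm : m < M) {s : ℝ} (hs : s ∈ Icc (t m) (t (m + 1))) :
    prim (stepFun M t d) s = prim (stepFun M t d) (t m) + (s - t m) • d m := by
  have hi := (memLp_stepFun T M t d).integrableOn_Ioc
  have h0 : IntervalIntegrable (stepFun M t d) volume 0 (t m) :=
    (intervalIntegrable_iff_integrableOn_Ioc_of_le (ht.mem_Icc hm.le).1).2
      (hi.mono_set (Ioc_subset_Ioc_right (ht.mem_Icc hm.le).2))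
  have h1 : IntervalIntegrable (stepFun M t d) volume (t m) s :=
    (intervalIntegrable_iff_integrableOn_Ioc_of_le hs.1).2
      (hi.mono_set ((Ioc_subset_Ioc_right hs.2).trans (ht.Ioc_subset hm)))
  rw [prim, prim, ← intervalIntegral.integral_add_adjacent_intervals h0 h1,
    integral_congr_Ico hs.1 (v := fun _ => d m) fun r hr =>
      stepFun_apply ht d hm ⟨hr.1, hr.2.trans_le hs.2⟩, intervalIntegral.integral_const]

theorem pwAffine_node {T : ℝ} {M : ℕ} {t : ℕ → ℝ} (ht : IsPartition T M t) (V : ℕ → X) {m : ℕ}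
    (hm : m ≤ M) : pwAffine M t V (t m) = V m := by
  induction m with
  | zero => simp [pwAffine, prim, ht.zero]
  | succ m ih =>
    have h := ih (by omega)
    have hlt := ht.lt m (by omega)
    rw [pwAffine] at h ⊢
    rw [prim_stepFun_sub ht _ (by omega) (right_mem_Icc.2 hlt.le), ← add_assoc, h, slopes,
      smul_smul, mul_inv_cancel₀ (sub_pos.2 hlt).ne', one_smul]
    abel

/-- Expanding about the midpoint rather than a node makes the linear part mean-free on the interval.
-/
theorem pwAffine_apply {T : ℝ} {M : ℕ} {t : ℕ → ℝ} (ht : IsPartition T M t) (V : ℕ → X) {m : ℕ}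
    (hm : m < M) {s : ℝ} (hs : s ∈ Icc (t m) (t (m + 1))) :
    pwAffine M t V s = (2⁻¹ : ℝ) • (V m + V (m + 1)) + (s - (t m + t (m + 1)) / 2) • slopes t V m := by
  have h := pwAffine_node ht V hm.le
  have hlt := ht.lt m hm
  rw [pwAffine] at h ⊢
  rw [prim_stepFun_sub ht _ hm hs, ← add_assoc, h]
  have h2 : V (m + 1) = V m + (t (m + 1) - t m) • slopes t V m := by
    rw [slopes, smul_smul, mul_inv_cancel₀ (sub_pos.2 hlt).ne', one_smul]
    abel
  rw [h2]
  module

theorem continuousOn_pwAffine (T : ℝ) (M : ℕ) (t : ℕ → ℝ) (V : ℕ → X) :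
    ContinuousOn (pwAffine M t V) (Icc 0 T) :=
  continuousOn_const.add (continuousOn_prim (memLp_stepFun T M t _).integrableOn_Ioc)

end Partition

/-! ### The discrete dual problem and its stability. -/

section Discrete

variable {H V E : Type*} [NormedAddCommGroup H] [InnerProductSpace ℝ H] [CompleteSpace H]
  [NormedAddCommGroup V] [InnerProductSpace ℝ V] [CompleteSpace V]
  [NormedAddCommGroup E] [InnerProductSpace ℝ E] [CompleteSpace E]
  {J : V →L[ℝ] H} {D : V →L[ℝ] E}

/-- Lax–Milgram for `k⁻¹ (J u, J v) + (D u, D v) / 2`, coercive on `V` with constant `min k⁻¹ 2⁻¹`;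
the known endpoint `v₁` goes to the right-hand side. -/
theorem exists_dual_step
    (hV : ∀ u v : V, inner ℝ u v = inner ℝ (J u) (J v) + inner ℝ (D u) (D v))
    {k : ℝ} (hk : 0 < k) (v₁ e : V) : ∃ v₀ : V, ∀ φ : V,
      -inner ℝ (J (k⁻¹ • (v₁ - v₀))) (J φ) + inner ℝ (D ((2⁻¹ : ℝ) • (v₀ + v₁))) (D φ)
        = inner ℝ (J e) (J φ) := by
  let B : V →L[ℝ] V →L[ℝ] ℝ :=
    k⁻¹ • (innerComp J).comp J + (2⁻¹ : ℝ) • (innerComp D).comp D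
  have hB (u v : V) : B u v = k⁻¹ * inner ℝ (J u) (J v) + 2⁻¹ * inner ℝ (D u) (D v) := rfl
  have hc : IsCoercive B := by
    refine ⟨min k⁻¹ 2⁻¹, lt_min (inv_pos.2 hk) (by norm_num), fun u => ?_⟩
    rw [hB, mul_assoc, ← real_inner_self_eq_norm_mul_norm, hV, mul_add]
    exact add_le_add (mul_le_mul_of_nonneg_right (min_le_left _ _) real_inner_self_nonneg)
      (mul_le_mul_of_nonneg_right (min_le_right _ _) real_inner_self_nonneg)
  let L : V →L[ℝ] ℝ := innerComp J (J e) + k⁻¹ • innerComp J (J v₁) - (2⁻¹ : ℝ) • innerComp D (D v₁)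
  have hL (φ : V) : L φ = inner ℝ (J e) (J φ) + k⁻¹ * inner ℝ (J v₁) (J φ)
      - 2⁻¹ * inner ℝ (D v₁) (D φ) := rfl
  obtain ⟨v₀, hv₀⟩ := hc.continuousLinearEquivOfBilin.surjective
    ((InnerProductSpace.toDual ℝ V).symm L)
  refine ⟨v₀, fun φ => ?_⟩
  have h1 : B v₀ φ = L φ := by
    rw [← hc.continuousLinearEquivOfBilin_apply, hv₀, InnerProductSpace.toDual_symm_apply]
  rw [hB, hL] at h1
  simp only [map_smul, map_sub, map_add, inner_smul_left, inner_sub_left, inner_add_left,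
    conj_trivial]
  linarith

theorem exists_dual_solution
    (hV : ∀ u v : V, inner ℝ u v = inner ℝ (J u) (J v) + inner ℝ (D u) (D v))
    {T : ℝ} {M : ℕ} {t : ℕ → ℝ} (ht : IsPartition T M t) (e : ℕ → V) : ∃ W : ℕ → V, W M = 0 ∧
      ∀ m < M, ∀ φ : V, -inner ℝ (J (slopes t W m)) (J φ)
        + inner ℝ (D ((2⁻¹ : ℝ) • (W m + W (m + 1)))) (D φ) = inner ℝ (J (e m)) (J φ) := by
  have hex (m : ℕ) (v₁ : V) : ∃ v₀ : V, m < M → ∀ φ : V,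
      -inner ℝ (J ((t (m + 1) - t m)⁻¹ • (v₁ - v₀))) (J φ)
        + inner ℝ (D ((2⁻¹ : ℝ) • (v₀ + v₁))) (D φ) = inner ℝ (J (e m)) (J φ) := by
    by_cases hm : m < M
    · obtain ⟨v₀, hv₀⟩ := exists_dual_step hV (sub_pos.2 (ht.lt m hm)) v₁ (e m)
      exact ⟨v₀, fun _ => hv₀⟩
    · exact ⟨0, fun h => absurd h hm⟩
  choose g hg using hex
  -- Backward recursion: `U j` is the value at node `M - j`, starting from the end value zero.
  let U : ℕ → V := fun j => Nat.rec 0 (fun j v => g (M - (j + 1)) v) j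
  have hU (j : ℕ) : U (j + 1) = g (M - (j + 1)) (U j) := rfl
  refine ⟨fun m => U (M - m), by simp [U], fun m hm φ => ?_⟩
  have h1 : U (M - m) = g m (U (M - (m + 1))) := by
    have h2 : M - m = (M - (m + 1)) + 1 := by omega
    have h3 : M - (M - (m + 1) + 1) = m := by omega
    rw [h2, hU, h3]
  have h := hg m (U (M - (m + 1))) hm φ
  rw [← h1] at h
  exact h

/-- Test with the slope itself. Multiplied by the step length, the gradient term is half the
increment of `‖D W‖²`; the increments telescope to `-‖D (W 0)‖²`, and Young's inequality absorbs the
slope. -/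
theorem dual_stability {T : ℝ} {M : ℕ} {t : ℕ → ℝ} (ht : IsPartition T M t) {e W : ℕ → V}
    (hM : W M = 0) (hW : ∀ m < M, ∀ φ : V, -inner ℝ (J (slopes t W m)) (J φ)
        + inner ℝ (D ((2⁻¹ : ℝ) • (W m + W (m + 1)))) (D φ) = inner ℝ (J (e m)) (J φ)) :
    ∑ m ∈ Finset.range M, (t (m + 1) - t m) * ‖J (slopes t W m)‖ ^ 2
      ≤ ∑ m ∈ Finset.range M, (t (m + 1) - t m) * ‖J (e m)‖ ^ 2 := by
  have h1 : ∀ m ∈ Finset.range M, (t (m + 1) - t m) * ‖J (slopes t W m)‖ ^ 2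
      ≤ (t (m + 1) - t m) * ‖J (e m)‖ ^ 2 + (‖D (W (m + 1))‖ ^ 2 - ‖D (W m)‖ ^ 2) := by
    intro m hm
    rw [Finset.mem_range] at hm
    have hk := sub_pos.2 (ht.lt m hm)
    set k := t (m + 1) - t m
    have h2 := hW m hm (slopes t W m)
    rw [real_inner_self_eq_norm_sq] at h2
    have h3 : k * inner ℝ (D ((2⁻¹ : ℝ) • (W m + W (m + 1)))) (D (slopes t W m))
        = (‖D (W (m + 1))‖ ^ 2 - ‖D (W m)‖ ^ 2) / 2 := by
      rw [slopes, map_smul, map_smul, inner_smul_left, inner_smul_right, map_add, map_sub,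
        inner_add_left, inner_sub_right, inner_sub_right, real_inner_self_eq_norm_sq,
        real_inner_self_eq_norm_sq, real_inner_comm (D (W m)) (D (W (m + 1))), conj_trivial]
      change k * (2⁻¹ * (k⁻¹ * _)) = _
      field_simp
      ring
    have h4 : -inner ℝ (J (e m)) (J (slopes t W m))
        ≤ (‖J (e m)‖ ^ 2 + ‖J (slopes t W m)‖ ^ 2) / 2 := by
      have := real_inner_le_norm (-J (e m)) (J (slopes t W m))
      rw [inner_neg_left, norm_neg] at this
      nlinarith [sq_nonneg (‖J (e m)‖ - ‖J (slopes t W m)‖)]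
    have h5 := mul_le_mul_of_nonneg_left h4 hk.le
    have h6 := congrArg (fun x => k * x) h2
    simp only [mul_add, mul_neg, h3] at h6
    nlinarith
  refine (Finset.sum_le_sum h1).trans ?_
  rw [Finset.sum_add_distrib, Finset.sum_range_sub (fun m => ‖D (W m)‖ ^ 2), hM, map_zero, norm_zero]
  nlinarith [sq_nonneg ‖D (W 0)‖]

end Discrete

/-! ### The consistency error on one interval. -/

section Discrete

variable {H V E : Type*} [NormedAddCommGroup H] [InnerProductSpace ℝ H] [CompleteSpace H]
  [NormedAddCommGroup V] [InnerProductSpace ℝ V] [CompleteSpace V]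
  [NormedAddCommGroup E] [InnerProductSpace ℝ E] [CompleteSpace E]
  {J : V →L[ℝ] H} {D : V →L[ℝ] E}

/-- The terms with `d` in the time derivative and with `A` form a continuous linear functional of
`y`, which passes through the integral; only the weight `s - μ` sees more than `∫ y`. -/
theorem integral_form_affine {a b : ℝ} (hab : a ≤ b) {y : ℝ → V} (hy : IntegrableOn y (Ioc a b))
    (A d : V) (μ : ℝ) :
    ∫ s in a..b, (-inner ℝ (J d) (J (y s)) + inner ℝ (D (y s)) (D (A + (s - μ) • d)))
      = (-inner ℝ (J d) (J (∫ s in a..b, y s)) + inner ℝ (D A) (D (∫ s in a..b, y s)))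
        + ∫ s in a..b, (s - μ) * inner ℝ (D (y s)) (D d) := by
  let L : V →L[ℝ] ℝ := -innerComp J (J d) + innerComp D (D A)
  have hL (v : V) : L v = -inner ℝ (J d) (J v) + inner ℝ (D A) (D v) := rfl
  have hyi : IntervalIntegrable y volume a b :=
    (intervalIntegrable_iff_integrableOn_Ioc_of_le hab).2 hy
  have hDi : IntervalIntegrable (fun s => inner ℝ (D (y s)) (D d)) volume a b :=
    (intervalIntegrable_iff_integrableOn_Ioc_of_le hab).2 ((D.integrable_comp hy).inner_const _)
  have h1 : IntervalIntegrable (fun s => (s - μ) * inner ℝ (D (y s)) (D d)) volume a b :=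
    hDi.continuousOn_mul (by fun_prop)
  have h2 : IntervalIntegrable (fun s => L (y s)) volume a b :=
    (intervalIntegrable_iff_integrableOn_Ioc_of_le hab).2 (L.integrable_comp hy)
  rw [← hL, ← L.intervalIntegral_comp_comm hyi, ← intervalIntegral.integral_add h2 h1]
  refine intervalIntegral.integral_congr fun s _ => ?_
  simp only [hL, map_add, map_smul, inner_add_right, inner_smul_right]
  rw [real_inner_comm (D A)]
  ring

theorem integral_sub_midpoint (a b : ℝ) : ∫ s in a..b, (s - (a + b) / 2) = 0 := by
  rw [intervalIntegral.integral_sub (by simp) (by simp), integral_id, intervalIntegral.integral_const,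
    smul_eq_mul]
  ring

/-- As the weight has mean zero, `c + prim z s` may be replaced by its change since `a`, which is at
most `∫ ‖z‖`. The weight and the interval length each contribute a factor `b - a`; Cauchy–Schwarz
for `∫ ‖z‖` and Young's inequality finish. -/
theorem integral_sub_midpoint_mul_le {T a b : ℝ} (ha : 0 ≤ a) (hab : a < b) (hb : b ≤ T)
    {z : ℝ → H} (hz : MemLp z 2 (timeMeasure T)) (c e : H) {g : ℝ → ℝ}
    (hg : ∀ᵐ s ∂timeMeasure T, g s = -inner ℝ (c + prim z s) e) :
    ∫ s in a..b, (s - (a + b) / 2) * g s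
      ≤ ((b - a) * ‖e‖ ^ 2 + (b - a) ^ 4 * ∫ s in a..b, ‖z s‖ ^ 2) / 2 := by
  have hz' := hz.integrableOn_Ioc
  have hzab : IntegrableOn z (Ioc a b) := hz'.mono_set (Ioc_subset_Ioc ha hb)
  have hcont : ContinuousOn (prim z) (uIcc a b) := by
    rw [uIcc_of_le hab.le]
    exact (continuousOn_prim hz').mono (Icc_subset_Icc ha hb)
  have h1 : ∫ s in a..b, (s - (a + b) / 2) * g s
      = ∫ s in a..b, (s - (a + b) / 2) * -inner ℝ (c + prim z s) e := by
    rw [intervalIntegral.integral_of_le hab.le, intervalIntegral.integral_of_le hab.le,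
      integral_Ioc_eq_integral_Ioo, integral_Ioc_eq_integral_Ioo]
    refine integral_congr_ae ?_
    filter_upwards [ae_restrict_of_ae_restrict_of_subset (Ioo_subset_Ioo ha hb) hg] with s hs
    rw [hs]
  have h2 : ∫ s in a..b, (s - (a + b) / 2) * -inner ℝ (c + prim z s) e
      = ∫ s in a..b, (s - (a + b) / 2) * -inner ℝ (prim z s - prim z a) e := by
    have hi1 : IntervalIntegrable (fun s => (s - (a + b) / 2) * -inner ℝ (prim z s - prim z a) e)
        volume a b := by
      apply ContinuousOn.intervalIntegrable
      fun_prop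
    have hi2 : IntervalIntegrable (fun s => (s - (a + b) / 2) * -inner ℝ (c + prim z a) e)
        volume a b := by
      apply ContinuousOn.intervalIntegrable
      fun_prop
    rw [← add_zero (∫ s in a..b, (s - (a + b) / 2) * -inner ℝ (prim z s - prim z a) e)]
    have hzero : ∫ s in a..b, (s - (a + b) / 2) * -inner ℝ (c + prim z a) e = 0 := by
      rw [intervalIntegral.integral_mul_const, integral_sub_midpoint, zero_mul]
    rw [← hzero, ← intervalIntegral.integral_add hi1 hi2]
    refine intervalIntegral.integral_congr fun s _ => ?_
    simp only [inner_add_left, inner_sub_left]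
    ring
  set Z := ∫ s in a..b, ‖z s‖ with hZ
  have hZ0 : 0 ≤ Z := intervalIntegral.integral_nonneg hab.le fun _ _ => norm_nonneg _
  have hb1 : ∀ s ∈ uIoc a b, ‖(s - (a + b) / 2) * -inner ℝ (prim z s - prim z a) e‖
      ≤ (b - a) * (Z * ‖e‖) := by
    intro s hs
    rw [uIoc_of_le hab.le] at hs
    rw [norm_mul, norm_neg]
    have h3 : ‖s - (a + b) / 2‖ ≤ b - a := by
      rw [Real.norm_eq_abs, abs_le]
      constructor <;> linarith [hs.1, hs.2]
    have h4 : ‖prim z s - prim z a‖ ≤ Z := by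
      have hi0 : IntervalIntegrable z volume 0 a :=
        (intervalIntegrable_iff_integrableOn_Ioc_of_le ha).2
          (hz'.mono_set (Ioc_subset_Ioc_right (hab.le.trans hb)))
      have his : IntervalIntegrable z volume a s :=
        (intervalIntegrable_iff_integrableOn_Ioc_of_le hs.1.le).2
          (hzab.mono_set (Ioc_subset_Ioc_right hs.2))
      rw [prim, prim, ← intervalIntegral.integral_add_adjacent_intervals hi0 his, add_sub_cancel_left,
        hZ, intervalIntegral.integral_of_le hs.1.le, intervalIntegral.integral_of_le hab.le]
      exact (norm_integral_le_integral_norm _).trans (setIntegral_mono_set hzab.norm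
        (ae_of_all _ fun r => norm_nonneg _) (Ioc_subset_Ioc_right hs.2).eventuallyLE)
    refine mul_le_mul h3 ((norm_inner_le_norm _ _).trans ?_) (norm_nonneg _) (by linarith)
    exact mul_le_mul_of_nonneg_right h4 (norm_nonneg _)
  have hb2 := intervalIntegral.norm_integral_le_of_norm_le_const hb1
  have hCS : Z ^ 2 ≤ (b - a) * ∫ s in a..b, ‖z s‖ ^ 2 := by
    have hm : MemLp z 2 (volume.restrict (Ioc a b)) := by
      rw [← restrict_Ioo_eq_restrict_Ioc]
      exact hz.mono_measure (Measure.restrict_mono (Ioo_subset_Ioo ha hb) le_rfl)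
    have := sq_integral_norm_le hm
    rw [hZ, intervalIntegral.integral_of_le hab.le, intervalIntegral.integral_of_le hab.le]
    simpa [Measure.real, hab.le] using this
  rw [abs_of_pos (sub_pos.2 hab)] at hb2
  rw [h1, h2]
  refine (le_abs_self _).trans (hb2.trans ?_)
  have hk := sub_pos.2 hab
  set k := b - a
  have h5 : k ^ 3 * Z ^ 2 ≤ k ^ 3 * (k * ∫ s in a..b, ‖z s‖ ^ 2) :=
    mul_le_mul_of_nonneg_left hCS (by positivity)
  -- Young's inequality in the form `2 k² Z ‖e‖ ≤ k ‖e‖² + k³ Z²`.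
  nlinarith [mul_nonneg hk.le (sq_nonneg (‖e‖ - k * Z))]

end Discrete

/-! ### Subtracting the weak equations and summing the errors. -/

section Discrete

variable {H V E : Type*} [NormedAddCommGroup H] [InnerProductSpace ℝ H] [CompleteSpace H]
  [NormedAddCommGroup V] [InnerProductSpace ℝ V] [CompleteSpace V]
  [NormedAddCommGroup E] [InnerProductSpace ℝ E] [CompleteSpace E]
  {J : V →L[ℝ] H} {D : V →L[ℝ] E}

theorem integrable_inner_of_memLp {α : Type*} [MeasurableSpace α] {μ : Measure α} {u v : α → H}
    (hu : MemLp u 2 μ) (hv : MemLp v 2 μ) : Integrable (fun s => inner ℝ (u s) (v s)) μ :=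
  (hu.norm.integrable_mul hv.norm).mono' (hu.1.inner hv.1)
    (ae_of_all _ fun _ => norm_inner_le_norm _ _)

/-- In the dual of `V` the primitive of `y'` is the image of `w - w 0`. The test function `b + ∫ S`
vanishes at `T`, so integration by parts leaves only the initial term. -/
theorem integral_deriv_pairing {T : ℝ} (hT : 0 < T) {y' : ℝ → V →L[ℝ] ℝ} {y : ℝ → V} {w : ℝ → H}
    (hy : MemLp y 2 (timeMeasure T)) (hy' : MemLp y' 2 (timeMeasure T))
    (hd : HasWeakTimeDeriv T (fun s => innerComp J (J (y s))) y') (hw : ContinuousOn w (Icc 0 T))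
    (hyw : (fun s => J (y s)) =ᵐ[timeMeasure T] w) {S : ℝ → V} (hS : MemLp S 2 (timeMeasure T))
    {b : V} (hb : b + prim S T = 0) :
    ∫ s in Ioo 0 T, y' s (b + prim S s)
      = -(∫ s in Ioo 0 T, inner ℝ (J (S s)) (J (y s))) - inner ℝ (w 0) (J b) := by
  have hS' := hS.integrableOn_Ioc
  have hy'' := hy'.integrableOn_Ioc
  have hp : MemLp (prim S) 2 (timeMeasure T) := memLp_of_continuousOn (continuousOn_prim hS')
  have h1 := integral_bilin_primitive (ContinuousLinearMap.id ℝ (V →L[ℝ] ℝ)) hT.le hy'' hS'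
  simp only [ContinuousLinearMap.id_apply] at h1
  rw [← integral_Ioo_eq_interval hT (fun s => y' s (∫ r in (0 : ℝ)..s, S r)),
    ← integral_Ioo_eq_interval hT (fun r => (∫ s in (0 : ℝ)..r, y' s) (S r))] at h1
  have h2 : ∫ r in Ioo 0 T, (∫ s in (0 : ℝ)..r, y' s) (S r)
      = ∫ r in Ioo 0 T, (inner ℝ (J (S r)) (J (y r)) - inner ℝ (w 0) (J (S r))) := by
    refine integral_congr_ae ?_
    filter_upwards [hyw, ae_restrict_mem measurableSet_Ioo] with r hr hrT
    have h3 := innerComp_eq_add_prim hT hy' hd hw hyw (Ioo_subset_Icc_self hrT)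
    have h4 := congrArg (fun L : V →L[ℝ] ℝ => L (S r)) h3
    simp only [innerComp_apply, add_apply] at h4
    change (prim y' r) (S r) = _
    rw [real_inner_comm, hr, h4]
    ring
  have h5 : ∫ r in Ioo 0 T, inner ℝ (w 0) (J (S r)) = inner ℝ (w 0) (J (prim S T)) := by
    rw [integral_Ioo_eq_interval hT, map_prim J hS' (right_mem_Icc.2 hT.le), prim]
    exact (innerSL ℝ (w 0)).intervalIntegral_comp_comm
      ((intervalIntegrable_iff_integrableOn_Ioc_of_le hT.le).2 (J.integrable_comp hS'))
  have hi1 : Integrable (fun r => inner ℝ (J (S r)) (J (y r))) (timeMeasure T) :=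
    integrable_inner_of_memLp (J.comp_memLp' hS) (J.comp_memLp' hy)
  have hi2 : Integrable (fun r => inner ℝ (w 0) (J (S r))) (timeMeasure T) :=
    ((J.comp_memLp' hS).integrable (by norm_num)).const_inner _
  rw [h2, integral_sub hi1 hi2, h5] at h1
  have h6 : ∫ s in Ioo 0 T, y' s b = prim y' T b := by
    rw [integral_Ioo_eq_interval hT, prim]
    exact ContinuousLinearMap.intervalIntegral_apply
      ((intervalIntegrable_iff_integrableOn_Ioc_of_le hT.le).2 hy'') b |>.symm
  have h7 : ∫ s in Ioo 0 T, y' s (b + prim S s)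
      = (∫ s in Ioo 0 T, y' s b) + ∫ s in Ioo 0 T, y' s (prim S s) := by
    simp_rw [map_add]
    exact integral_add (integrable_pairing hy' (memLp_const b)) (integrable_pairing hy' hp)
  have h8 : ∫ s in Ioo 0 T, y' s (prim S s) = prim y' T (prim S T)
      - ((∫ s in Ioo 0 T, inner ℝ (J (S s)) (J (y s))) - inner ℝ (w 0) (J (prim S T))) := h1
  have h9 : prim S T = -b := by rw [eq_neg_iff_add_eq_zero, add_comm, hb]
  rw [h7, h6, h8, h9, map_neg, map_neg, inner_neg_right]
  ring

/-- Puts the time derivative on the test function, as in the scheme, so that the two equations can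
be subtracted. -/
theorem weak_formulation_pwAffine {T : ℝ} (hT : 0 < T) {M : ℕ} {t : ℕ → ℝ} (ht : IsPartition T M t)
    {f y' : ℝ → V →L[ℝ] ℝ} {y : ℝ → V} {w : ℝ → H}
    (hy : MemLp y 2 (timeMeasure T)) (hy' : MemLp y' 2 (timeMeasure T))
    (hd : HasWeakTimeDeriv T (fun s => innerComp J (J (y s))) y') (hw : ContinuousOn w (Icc 0 T))
    (hyw : (fun s => J (y s)) =ᵐ[timeMeasure T] w)
    (h : ∀ v : ℝ → V, MemLp v 2 (timeMeasure T) →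
      ∫ s in Ioo 0 T, (y' s (v s) + inner ℝ (D (y s)) (D (v s))) = ∫ s in Ioo 0 T, f s (v s))
    {W : ℕ → V} (hW : W M = 0) :
    ∫ s in Ioo 0 T, (-inner ℝ (J (stepFun M t (slopes t W) s)) (J (y s))
        + inner ℝ (D (y s)) (D (pwAffine M t W s)))
      = (∫ s in Ioo 0 T, f s (pwAffine M t W s)) + inner ℝ (w 0) (J (W 0)) := by
  have hS := memLp_stepFun T M t (slopes t W)
  have hv : MemLp (pwAffine M t W) 2 (timeMeasure T) :=
    memLp_of_continuousOn (continuousOn_pwAffine T M t W)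
  have hb : W 0 + prim (stepFun M t (slopes t W)) T = 0 := by
    have := pwAffine_node ht W le_rfl
    rwa [hW, ht.last] at this
  have h1 : ∫ s in Ioo 0 T, y' s (pwAffine M t W s) = _ :=
    integral_deriv_pairing hT hy hy' hd hw hyw hS hb
  have hi1 : Integrable (fun s => inner ℝ (J (stepFun M t (slopes t W) s)) (J (y s))) (timeMeasure T) :=
    integrable_inner_of_memLp (J.comp_memLp' hS) (J.comp_memLp' hy)
  have hi2 : Integrable (fun s => inner ℝ (D (y s)) (D (pwAffine M t W s))) (timeMeasure T) :=
    integrable_inner_of_memLp (D.comp_memLp' hy) (D.comp_memLp' hv)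
  have hi1' : Integrable (fun s => -inner ℝ (J (stepFun M t (slopes t W) s)) (J (y s)))
      (timeMeasure T) := hi1.neg
  rw [← h _ hv, integral_add (integrable_pairing hy' hv) hi2, h1, integral_add hi1' hi2,
    integral_neg]
  ring

/-- The error estimate for the nodal values of the Petrov–Galerkin solution. -/
theorem sum_error_le
    (hV : ∀ u v : V, inner ℝ u v = inner ℝ (J u) (J v) + inner ℝ (D u) (D v))
    {T : ℝ} (hT : 0 < T) {M : ℕ} {t : ℕ → ℝ} (ht : IsPartition T M t) {K : ℝ}
    (hK : ∀ m < M, t (m + 1) - t m ≤ K)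
    {f y' : ℝ → V →L[ℝ] ℝ} {y : ℝ → V} {w : ℝ → H}
    (hy : MemLp y 2 (timeMeasure T)) (hy' : MemLp y' 2 (timeMeasure T))
    (hd : HasWeakTimeDeriv T (fun s => innerComp J (J (y s))) y') (hw : ContinuousOn w (Icc 0 T))
    (hyw : (fun s => J (y s)) =ᵐ[timeMeasure T] w)
    (h : ∀ v : ℝ → V, MemLp v 2 (timeMeasure T) →
      ∫ s in Ioo 0 T, (y' s (v s) + inner ℝ (D (y s)) (D (v s))) = ∫ s in Ioo 0 T, f s (v s))
    {z : ℝ → H} (hz : MemLp z 2 (timeMeasure T)) (c : H)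
    (hl : ∀ᵐ s ∂timeMeasure T, ∀ v, -inner ℝ (D (y s)) (D v) = inner ℝ (c + prim z s) (J v))
    {yk : ℝ → V} {cm : ℕ → V} (hyk : ∀ m < M, ∀ s ∈ Ico (t m) (t (m + 1)), yk s = cm m)
    (hdisc : ∀ W : ℕ → V, W M = 0 →
      ∫ s in Ioo 0 T, (-inner ℝ (J (stepFun M t (slopes t W) s)) (J (yk s))
        + inner ℝ (D (yk s)) (D (pwAffine M t W s)))
      = (∫ s in Ioo 0 T, f s (pwAffine M t W s)) + inner ℝ (w 0) (J (W 0))) :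
    ∑ m ∈ Finset.range M, (t (m + 1) - t m)
        * ‖J (cm m - (t (m + 1) - t m)⁻¹ • ∫ s in (t m)..(t (m + 1)), y s)‖ ^ 2
      ≤ K ^ 4 * ∫ s in (0 : ℝ)..T, ‖z s‖ ^ 2 := by
  set e : ℕ → V := fun m => cm m - (t (m + 1) - t m)⁻¹ • ∫ s in (t m)..(t (m + 1)), y s with he
  obtain ⟨W, hWM, hW⟩ := exists_dual_solution hV ht e
  have hstab := dual_stability ht hWM hW
  have hv : MemLp (pwAffine M t W) 2 (timeMeasure T) :=
    memLp_of_continuousOn (continuousOn_pwAffine T M t W)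
  have hS := memLp_stepFun T M t (slopes t W)
  have hform {u : ℝ → V} (hu : MemLp u 2 (timeMeasure T)) :
      ∫ s in Ioo 0 T, (-inner ℝ (J (stepFun M t (slopes t W) s)) (J (u s))
        + inner ℝ (D (u s)) (D (pwAffine M t W s)))
      = ∑ m ∈ Finset.range M, ((-inner ℝ (J (slopes t W m)) (J (∫ s in (t m)..(t (m + 1)), u s))
          + inner ℝ (D ((2⁻¹ : ℝ) • (W m + W (m + 1)))) (D (∫ s in (t m)..(t (m + 1)), u s)))
        + ∫ s in (t m)..(t (m + 1)), (s - (t m + t (m + 1)) / 2)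
            * inner ℝ (D (u s)) (D (slopes t W m))) := by
    have hi : MemLp (fun s => J (u s)) 2 (timeMeasure T) := J.comp_memLp' hu
    have hint : Integrable (fun s => -inner ℝ (J (stepFun M t (slopes t W) s)) (J (u s))
        + inner ℝ (D (u s)) (D (pwAffine M t W s))) (timeMeasure T) :=
      (integrable_inner_of_memLp (J.comp_memLp' hS) hi).neg.add
        (integrable_inner_of_memLp (D.comp_memLp' hu) (D.comp_memLp' hv))
    rw [integral_Ioo_eq_interval hT,
      ← ht.sum_integral ((integrableOn_Ioc_iff_integrableOn_Ioo (μ := volume)).2 hint)]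
    refine Finset.sum_congr rfl fun m hm => ?_
    rw [Finset.mem_range] at hm
    rw [← integral_form_affine (ht.lt m hm).le (hu.integrableOn_Ioc.mono_set (ht.Ioc_subset hm))]
    refine integral_congr_Ico (ht.lt m hm).le fun s hs => ?_
    rw [stepFun_apply ht _ hm hs, pwAffine_apply ht W hm (Ico_subset_Icc_self hs)]
  have hykm : MemLp (stepFun M t cm) 2 (timeMeasure T) := memLp_stepFun T M t cm
  have hstep : ∫ s in Ioo 0 T, (-inner ℝ (J (stepFun M t (slopes t W) s)) (J (yk s))
        + inner ℝ (D (yk s)) (D (pwAffine M t W s)))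
      = ∫ s in Ioo 0 T, (-inner ℝ (J (stepFun M t (slopes t W) s)) (J (stepFun M t cm s))
        + inner ℝ (D (stepFun M t cm s)) (D (pwAffine M t W s))) := by
    refine setIntegral_congr_fun measurableSet_Ioo fun s hs => ?_
    obtain ⟨m, hm, hsm⟩ := ht.exists_mem_Ico (Ioo_subset_Ico_self hs)
    simp only [hyk m hm s hsm, stepFun_apply ht cm hm hsm]
  have horth := (hdisc W hWM).trans
    (weak_formulation_pwAffine hT ht hy hy' hd hw hyw h hWM).symm
  rw [hstep, hform hykm, hform hy] at horth
  -- Galerkin orthogonality: the part depending on interval integrals is the dual equation tested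
  -- with `e m`, and the weighted term of the step function vanishes because the weight has mean
  -- zero.
  have hid : ∑ m ∈ Finset.range M, (t (m + 1) - t m) * ‖J (e m)‖ ^ 2
      = ∑ m ∈ Finset.range M, ∫ s in (t m)..(t (m + 1)), (s - (t m + t (m + 1)) / 2)
            * inner ℝ (D (y s)) (D (slopes t W m)) := by
    rw [← sub_eq_zero, ← Finset.sum_sub_distrib, ← sub_eq_zero.2 horth, ← Finset.sum_sub_distrib]
    refine Finset.sum_congr rfl fun m hm => ?_
    rw [Finset.mem_range] at hm
    have hk := sub_pos.2 (ht.lt m hm)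
    have h1 : ∫ s in (t m)..(t (m + 1)), stepFun M t cm s = (t (m + 1) - t m) • cm m := by
      rw [integral_congr_Ico (ht.lt m hm).le (v := fun _ => cm m)
        fun s hs => stepFun_apply ht cm hm hs, intervalIntegral.integral_const]
    have h2 : ∫ s in (t m)..(t (m + 1)), (s - (t m + t (m + 1)) / 2)
        * inner ℝ (D (stepFun M t cm s)) (D (slopes t W m)) = 0 := by
      rw [integral_congr_Ico (ht.lt m hm).le (v := fun s => (s - (t m + t (m + 1)) / 2)
        * inner ℝ (D (cm m)) (D (slopes t W m))) fun s hs => by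
          rw [stepFun_apply ht cm hm hs], intervalIntegral.integral_mul_const,
        integral_sub_midpoint, zero_mul]
    have h3 : ∫ s in (t m)..(t (m + 1)), y s = (t (m + 1) - t m) • (cm m - e m) := by
      rw [he, sub_sub_cancel, smul_smul, mul_inv_cancel₀ hk.ne', one_smul]
    have h4 := hW m hm (e m)
    rw [real_inner_self_eq_norm_sq] at h4
    rw [h1, h2, h3, ← h4]
    simp only [map_smul, map_sub, inner_smul_right, inner_sub_right]
    ring
  have hrem : ∀ m ∈ Finset.range M, ∫ s in (t m)..(t (m + 1)), (s - (t m + t (m + 1)) / 2)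
      * inner ℝ (D (y s)) (D (slopes t W m))
      ≤ ((t (m + 1) - t m) * ‖J (slopes t W m)‖ ^ 2
        + K ^ 4 * ∫ s in (t m)..(t (m + 1)), ‖z s‖ ^ 2) / 2 := by
    intro m hm
    rw [Finset.mem_range] at hm
    have hk := sub_pos.2 (ht.lt m hm)
    have h1 := integral_sub_midpoint_mul_le (ht.mem_Icc hm.le).1 (ht.lt m hm) (ht.mem_Icc hm).2 hz c
      (J (slopes t W m)) (g := fun s => inner ℝ (D (y s)) (D (slopes t W m))) (by
        filter_upwards [hl] with s hs
        rw [← hs, neg_neg])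
    have h2 : (t (m + 1) - t m) ^ 4 ≤ K ^ 4 := pow_le_pow_left₀ hk.le (hK m hm) 4
    have h3 : 0 ≤ ∫ s in (t m)..(t (m + 1)), ‖z s‖ ^ 2 :=
      intervalIntegral.integral_nonneg (ht.lt m hm).le fun _ _ => sq_nonneg _
    nlinarith [mul_le_mul_of_nonneg_right h2 h3]
  have hsum := Finset.sum_le_sum hrem
  rw [← hid, ← Finset.sum_div, Finset.sum_add_distrib, ← Finset.mul_sum,
    ht.sum_integral ((integrableOn_Ioc_iff_integrableOn_Ioo (μ := volume)).2 hz.norm.integrable_sq)] at hsum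
  -- With `S` the sum to be bounded, `hsum` and `hstab` give `S ≤ (S + K⁴ ∫ ‖z‖²) / 2`.
  linarith

end Discrete

/-! ### Weak Laplacians under time derivatives, and norms of step functions. -/

section Abstract

variable {H V E : Type*} [NormedAddCommGroup H] [InnerProductSpace ℝ H] [CompleteSpace H]
  [NormedAddCommGroup V] [InnerProductSpace ℝ V] [CompleteSpace V]
  [NormedAddCommGroup E] [InnerProductSpace ℝ E] [CompleteSpace E]
  {J : V →L[ℝ] H} {D : V →L[ℝ] E}

theorem integrable_smul_of_continuous {X : Type*} [NormedAddCommGroup X] [NormedSpace ℝ X] {T : ℝ}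
    {φ : ℝ → ℝ} (hφ : Continuous φ) {v : ℝ → X} (hv : MemLp v 2 (timeMeasure T)) :
    Integrable (fun s => φ s • v s) (timeMeasure T) := by
  obtain ⟨C, hC⟩ := isCompact_Icc.exists_bound_of_continuousOn (hφ.continuousOn (s := Icc 0 T))
  refine (hv.integrable (by norm_num)).bdd_smul C hφ.aestronglyMeasurable ?_
  filter_upwards [ae_restrict_mem measurableSet_Ioo] with s hs
  exact hC s (Ioo_subset_Icc_self hs)

theorem inner_integral_laplacian {T : ℝ} {y : ℝ → V} {l : ℝ → H}
    (hy : MemLp y 2 (timeMeasure T)) (hlm : MemLp l 2 (timeMeasure T))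
    (hl : ∀ᵐ s ∂timeMeasure T, ∀ v, -inner ℝ (D (y s)) (D v) = inner ℝ (l s) (J v))
    {φ : ℝ → ℝ} (hφ : Continuous φ) (v : V) :
    inner ℝ (J v) (∫ s in Ioo 0 T, φ s • l s)
      = -inner ℝ (D v) (D (∫ s in Ioo 0 T, φ s • y s)) := by
  have h1 := integrable_smul_of_continuous hφ hy
  have h2 := integrable_smul_of_continuous hφ hlm
  have h3 := ((innerSL ℝ (J v)).integral_comp_comm h2).symm
  have h4 := (((innerSL ℝ (D v)).comp D).integral_comp_comm h1).symm
  simp only [ContinuousLinearMap.comp_apply, innerSL_apply_apply] at h3 h4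
  rw [h3, h4, ← integral_neg]
  refine integral_congr_ae ?_
  filter_upwards [hl] with s hs
  have := hs v
  rw [map_smul, inner_smul_right, inner_smul_right, real_inner_comm, ← this, real_inner_comm (D v)]
  ring

/-- Paired with `J v`, the claim becomes the derivative relation between `y` and `u` paired with `D
v`; density of the range of `J` removes the pairing. -/
theorem hasWeakTimeDeriv_laplacian (hJ : DenseRange J) {T : ℝ} {y u : ℝ → V} {l z : ℝ → H}
    (hy : MemLp y 2 (timeMeasure T)) (hu : MemLp u 2 (timeMeasure T))
    (hyu : HasWeakTimeDeriv T y u)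
    (hlm : MemLp l 2 (timeMeasure T)) (hzm : MemLp z 2 (timeMeasure T))
    (hl : ∀ᵐ s ∂timeMeasure T, ∀ v, -inner ℝ (D (y s)) (D v) = inner ℝ (l s) (J v))
    (hz : ∀ᵐ s ∂timeMeasure T, ∀ v, -inner ℝ (D (u s)) (D v) = inner ℝ (z s) (J v)) :
    HasWeakTimeDeriv T l z := by
  intro φ hφ hc hs
  have hφ' : Continuous (deriv φ) := hφ.continuous_deriv (by simp)
  refine hJ.eq_of_inner_right (𝕜 := ℝ) fun v => ?_
  rw [inner_integral_laplacian hy hlm hl hφ' v, hyu φ hφ hc hs, inner_neg_right,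
    inner_integral_laplacian hu hzm hz hφ.continuous v, map_neg, inner_neg_right]

theorem memLp_innerComp_stepFun (T : ℝ) (M : ℕ) (t : ℕ → ℝ) (d : ℕ → V) :
    MemLp (fun s => innerComp J (J (stepFun M t d s))) 2 (timeMeasure T) :=
  ((innerComp J).comp J).comp_memLp' (memLp_stepFun T M t d)

theorem hasWeakTimeDeriv_pwAffine {T : ℝ} (hT : 0 < T) (M : ℕ) (t : ℕ → ℝ) (W : ℕ → V) :
    HasWeakTimeDeriv T (fun s => innerComp J (J (pwAffine M t W s)))
      (fun s => innerComp J (J (stepFun M t (slopes t W) s))) := by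
  refine hasWeakTimeDeriv_of_eq_prim hT (innerComp J (J (W 0)))
    (memLp_innerComp_stepFun T M t _).integrableOn_Ioc ?_
  filter_upwards [ae_restrict_mem measurableSet_Ioo] with s hs
  rw [pwAffine, map_add, map_add]
  congr 1
  exact map_prim ((innerComp J).comp J) (memLp_stepFun T M t _).integrableOn_Ioc
    (Ioo_subset_Icc_self hs)

theorem eLpNorm_le_of_integral_sq_le {α : Type*} [MeasurableSpace α] {μ : Measure α} {u z : α → H}
    (hu : MemLp u 2 μ) (hz : MemLp z 2 μ) {K : ℝ} (hK : 0 ≤ K)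
    (h : ∫ x, ‖u x‖ ^ 2 ∂μ ≤ K ^ 2 * ∫ x, ‖z x‖ ^ 2 ∂μ) :
    eLpNorm u 2 μ ≤ ENNReal.ofReal K * eLpNorm z 2 μ := by
  have hn {v : α → H} (hv : MemLp v 2 μ) : (eLpNorm v 2 μ).toReal ^ 2 = ∫ x, ‖v x‖ ^ 2 ∂μ := by
    rw [← Lp.norm_toLp v hv, norm_sq_Lp_two]
    refine integral_congr_ae ?_
    filter_upwards [hv.coeFn_toLp] with x hx
    rw [hx]
  rw [← hn hu, ← hn hz, ← mul_pow] at h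
  have h1 := abs_le_of_sq_le_sq' h (by positivity) |>.2
  rw [← ENNReal.ofReal_toReal hu.eLpNorm_ne_top, ← ENNReal.ofReal_toReal hz.eLpNorm_ne_top,
    ← ENNReal.ofReal_mul hK]
  exact ENNReal.ofReal_le_ofReal h1

theorem memLp_and_integral_sq_of_step {T : ℝ} (hT : 0 < T) {M : ℕ} {t : ℕ → ℝ}
    (ht : IsPartition T M t) {u : ℝ → H} {d : ℕ → H}
    (hu : ∀ m < M, ∀ s ∈ Ico (t m) (t (m + 1)), u s = d m) :
    MemLp u 2 (timeMeasure T) ∧ ∫ s in Ioo 0 T, ‖u s‖ ^ 2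
      = ∑ m ∈ Finset.range M, (t (m + 1) - t m) * ‖d m‖ ^ 2 := by
  have h1 : u =ᵐ[timeMeasure T] stepFun M t d := by
    filter_upwards [ae_restrict_mem measurableSet_Ioo] with s hs
    obtain ⟨m, hm, hsm⟩ := ht.exists_mem_Ico (Ioo_subset_Ico_self hs)
    rw [hu m hm s hsm, stepFun_apply ht d hm hsm]
  have h2 : MemLp u 2 (timeMeasure T) := (memLp_congr_ae h1).2 (memLp_stepFun T M t d)
  refine ⟨h2, ?_⟩
  rw [integral_Ioo_eq_interval hT, ← ht.sum_integral
    ((integrableOn_Ioc_iff_integrableOn_Ioo (μ := volume)).2 h2.norm.integrable_sq)]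
  refine Finset.sum_congr rfl fun m hm => ?_
  rw [Finset.mem_range] at hm
  rw [integral_congr_Ico (ht.lt m hm).le (v := fun _ => ‖d m‖ ^ 2) fun s hs => by
    rw [hu m hm s hs], intervalIntegral.integral_const, smul_eq_mul]

end Abstract

theorem IsPartition.sub_le_meshSize {M : ℕ} (t : ℕ → ℝ) {m : ℕ} (hm : m < M) :
    t (m + 1) - t m ≤ meshSize M t :=
  le_ciSup (f := fun m : Fin M => t (m + 1) - t m) (Set.finite_range _).bddAbove ⟨m, hm⟩

/-! ### Application to the heat equation on `Ω`. -/

section Heat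

variable {n : ℕ} {Ω : Set (Space n)}

/-- The defect of the identity is a continuous linear functional `Λ` of the pair `(v, ∇v)`. Summing
the diagonal Hessian relations shows that it vanishes on test pairs, hence on their closed span. -/
theorem isLaplacian_of_isWeakHessian {u : H10 Ω} {h : Fin n → Fin n → L2 Ω}
    (hu : IsWeakHessian u h) : IsLaplacian u (∑ i, h i i) := by
  let Λ : WithLp 2 (L2 Ω × L2Vec Ω) →L[ℝ] ℝ :=
    (innerSL ℝ (grad Ω u)).comp (WithLp.sndL 2 ℝ (L2 Ω) (L2Vec Ω))
      + (innerSL ℝ (∑ i, h i i)).comp (WithLp.fstL 2 ℝ (L2 Ω) (L2Vec Ω))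
  have hΛ (p : WithLp 2 (L2 Ω × L2Vec Ω)) :
      Λ p = inner ℝ (grad Ω u) p.snd + inner ℝ (∑ i, h i i) p.fst := rfl
  have hle : H10 Ω ≤ Λ.ker := by
    refine Submodule.topologicalClosure_minimal _ (Submodule.span_le.2 ?_) Λ.isClosed_ker
    rintro p ⟨φ, hφ, hp1, hp2⟩
    change Λ p = 0
    have hgL (i : Fin n) : MemLp (fun x => (∇ φ x) i) 2 (volume.restrict Ω) :=
      ((EuclideanSpace.proj i : Space n →L[ℝ] ℝ).comp_memLp' (Lp.memLp p.snd)).ae_eq (by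
        filter_upwards [hp2] with x hx
        simp [hx])
    have huL (i : Fin n) : MemLp (fun x => (grad Ω u : Space n → Space n) x i) 2 (volume.restrict Ω) :=
      (EuclideanSpace.proj i : Space n →L[ℝ] ℝ).comp_memLp' (Lp.memLp (grad Ω u))
    have h1 : inner ℝ (grad Ω u) p.snd
        = ∑ i, ∫ x in Ω, (grad Ω u : Space n → Space n) x i * (∇ φ x) i := by
      have hint (i : Fin n) : Integrable (fun x => (grad Ω u : Space n → Space n) x i * (∇ φ x) i)
          (volume.restrict Ω) := (huL i).integrable_mul (hgL i)
      rw [← integral_finsetSum _ fun i _ => hint i, L2.inner_def]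
      refine integral_congr_ae ?_
      filter_upwards [hp2] with x hx
      rw [hx, PiLp.inner_apply]
      exact Finset.sum_congr rfl fun i _ => by simp [mul_comm]
    have h2 : inner ℝ (∑ i, h i i) p.fst = ∑ i, ∫ x in Ω, (h i i : Space n → ℝ) x * φ x := by
      rw [sum_inner]
      refine Finset.sum_congr rfl fun i _ => ?_
      rw [L2.inner_def]
      refine integral_congr_ae ?_
      filter_upwards [hp1] with x hx
      rw [hx]
      simp [mul_comm]
    rw [hΛ, h1, h2, ← Finset.sum_add_distrib]
    exact Finset.sum_eq_zero fun i _ => by rw [hu i i φ hφ, neg_add_cancel]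
  intro v
  have h3 : inner ℝ (grad Ω u) (grad Ω v) + inner ℝ (∑ i, h i i) (toL2 Ω v) = 0 := hle v.2
  rw [dirichlet]
  linarith

/-- Because `W M = 0`, the end term of `formA` disappears, and with it the value of `yk` at `T`,
which the ansatz space leaves free. -/
theorem isDiscreteSolution_pwAffine {T : ℝ} (hT : 0 < T) {M : ℕ} {t : ℕ → ℝ}
    (ht : IsPartition T M t) {f : ℝ → Hneg1 Ω} {κ : L2 Ω} {yk : ℝ → H10 Ω}
    (h : IsDiscreteSolution T M t f κ yk) {W : ℕ → H10 Ω} (hW : W M = 0) :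
    ∫ s in Ioo 0 T, (-inner ℝ (toL2 Ω (stepFun M t (slopes t W) s)) (toL2 Ω (yk s))
        + inner ℝ (grad Ω (yk s)) (grad Ω (pwAffine M t W s)))
      = (∫ s in Ioo 0 T, f s (pwAffine M t W s)) + inner ℝ κ (toL2 Ω (W 0)) := by
  have hcont := continuousOn_pwAffine T M t W
  have htest : pwAffine M t W ∈ testSpace Ω T M t := by
    refine ⟨hcont, fun m hm => ⟨(2⁻¹ : ℝ) • (W m + W (m + 1))
      - ((t m + t (m + 1)) / 2) • slopes t W m, slopes t W m, fun s hs => ?_⟩⟩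
    rw [pwAffine_apply ht W hm (Ico_subset_Icc_self hs), sub_smul]
    abel
  have h1 := h.2 _ htest (fun s => l2ToDual Ω (toL2 Ω (stepFun M t (slopes t W) s)))
    ⟨memLp_of_continuousOn hcont, memLp_innerComp_stepFun (J := toL2 Ω) T M t (slopes t W),
      hasWeakTimeDeriv_pwAffine (J := toL2 Ω) hT M t W⟩
  have h0 : pwAffine M t W 0 = W 0 := by
    have := pwAffine_node ht W (Nat.zero_le M)
    rwa [ht.zero] at this
  have hT' : pwAffine M t W T = 0 := by
    have := pwAffine_node ht W le_rfl
    rwa [ht.last, hW] at this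
  rw [formA, h0, hT', map_zero, inner_zero_right, add_zero] at h1
  exact h1

theorem error_estimate {T : ℝ} (hT : 0 < T) {f : ℝ → Hneg1 Ω} {κ : L2 Ω} {y : ℝ → H10 Ω}
    (hy : IsWeakSolution T f κ y) {ytL : ℝ → L2 Ω} (hL : IsTimeDerivLaplacian T y ytL)
    {M : ℕ} {t : ℕ → ℝ} (ht : IsPartition T M t) {yk : ℝ → H10 Ω}
    (hyk : IsDiscreteSolution T M t f κ yk) :
    eLpNorm (fun s => toL2 Ω (yk s - meanProj M t y s)) 2 (timeMeasure T)
      ≤ ENNReal.ofReal (meshSize M t ^ 2) * eLpNorm ytL 2 (timeMeasure T) := by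
  obtain ⟨⟨w, hw, hyw, hw0⟩, y', hyy', hweak⟩ := hy
  obtain ⟨l, hl, hl'⟩ := hL
  obtain ⟨c, hc⟩ := eq_prim_of_hasWeakTimeDeriv hT hl'.mem.integrableOn_Ioc
    hl'.mem_deriv.integrableOn_Ioc hl'.deriv
  have hlc : ∀ᵐ s ∂timeMeasure T, ∀ v : H10 Ω,
      -inner ℝ (grad Ω (y s)) (grad Ω v) = inner ℝ (c + prim ytL s) (toL2 Ω v) := by
    filter_upwards [hl, hc] with s h1 h2 v
    rw [← h2]
    exact h1 v
  have hyk' : ∀ m, ∃ b : H10 Ω, m < M → ∀ s ∈ Ico (t m) (t (m + 1)), yk s = b := by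
    intro m
    by_cases hm : m < M
    · obtain ⟨b, hb⟩ := hyk.1 m hm
      exact ⟨b, fun _ => hb⟩
    · exact ⟨0, fun h => absurd h hm⟩
  choose cm hcm using hyk'
  have hsum := sum_error_le (J := toL2 Ω) (D := grad Ω) inner_H10 hT ht
    (fun m hm => IsPartition.sub_le_meshSize t hm) (f := f) hyy'.mem hyy'.mem_deriv hyy'.deriv hw
    hyw hweak hl'.mem_deriv c hlc hcm (fun W hW => by
      rw [hw0]
      exact isDiscreteSolution_pwAffine hT ht hyk hW)
  obtain ⟨h1, h2⟩ := memLp_and_integral_sq_of_step hT ht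
    (u := fun s => toL2 Ω (yk s - meanProj M t y s))
    (d := fun m => toL2 Ω (cm m - (t (m + 1) - t m)⁻¹ • ∫ s in (t m)..(t (m + 1)), y s))
    (fun m hm s hs => by
      have h3 : meanProj M t y s = (t (m + 1) - t m)⁻¹ • ∫ s in (t m)..(t (m + 1)), y s :=
        stepFun_apply ht (fun m => (t (m + 1) - t m)⁻¹ • ∫ s in (t m)..(t (m + 1)), y s) hm hs
      rw [h3, hcm m hm s hs])
  refine eLpNorm_le_of_integral_sq_le h1 hl'.mem_deriv (sq_nonneg _) ?_
  rw [h2, integral_Ioo_eq_interval hT, ← pow_mul]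
  exact hsum

theorem exists_timeDerivs_of_regularData (hΩ : IsOpen Ω) {T : ℝ} (hT : 0 < T) {f : ℝ → Hneg1 Ω}
    {κ : L2 Ω} {y : ℝ → H10 Ω} (hf : MemLp f 2 (timeMeasure T)) (hy : IsWeakSolution T f κ y)
    (hd : RegularData T f κ) :
    ∃ ytt ytL : ℝ → L2 Ω, IsSecondTimeDeriv T y ytt ∧ IsTimeDerivLaplacian T y ytL := by
  obtain ⟨⟨w, hw, hyw, hw0⟩, y', hyy', hweak⟩ := hy
  obtain ⟨⟨F, F', hF, hfF, g, wF, hwF, hFwF, hwF0⟩, κ₀, η, hκ, hη⟩ := hd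
  have hFF' : ∀ᵐ s ∂timeMeasure T, F s = toL2 Ω g + prim F' s := by
    filter_upwards [hFwF, ae_restrict_mem measurableSet_Ioo] with s hs hsT
    rw [hs, eq_add_prim_of_hasInitialValue hT hwF hFwF hF.mem_deriv.integrableOn_Ioc hF.deriv
      (Ioo_subset_Icc_self hsT), hwF0]
  obtain ⟨z, z', hz, hz', hyz, hzz', hlap⟩ := exists_regularity (J := toL2 Ω) (D := grad Ω)
    inner_H10 (denseRange_toL2 hΩ) hT hf hyy'.mem hyy'.mem_deriv hyy'.deriv hw hyw hweak
    hF.mem_deriv hfF hFF' (hw0.trans hκ.symm) hη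
  -- Here `z` is `∂ₜy` and the equation reads `Δy = z - F`, whence `∂ₜΔy = z' - F'`.
  refine ⟨z', fun s => z' s - F' s, ⟨z, ⟨(toL2 Ω).comp_memLp' hyy'.mem, hz, ?_⟩, hz, hz', ?_⟩,
    fun s => z s - F s, hlap, hz.sub hF.mem, hz'.sub hF.mem_deriv, ?_⟩
  · exact hasWeakTimeDeriv_of_eq_prim hT _ hz.integrableOn_Ioc hyz
  · exact hasWeakTimeDeriv_of_eq_prim hT _ hz'.integrableOn_Ioc hzz'
  · refine hasWeakTimeDeriv_of_eq_prim hT (toL2 Ω (g + η) - toL2 Ω g)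
      (hz'.sub hF.mem_deriv).integrableOn_Ioc ?_
    filter_upwards [hzz', hFF', ae_restrict_mem measurableSet_Ioo] with s h1 h2 hsT
    rw [h1, h2]
    have := prim_sub hz'.integrableOn_Ioc hF.mem_deriv.integrableOn_Ioc (Ioo_subset_Icc_self hsT)
    rw [show prim (fun r => z' r - F' r) s = prim z' s - prim F' s from this]
    abel

theorem exists_timeDerivLaplacian_of_memH1H2 (hΩ : IsOpen Ω) {T : ℝ} {y : ℝ → H10 Ω}
    (hy : MemH1H2 T y) : ∃ ytL : ℝ → L2 Ω, IsTimeDerivLaplacian T y ytL := by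
  obtain ⟨⟨hym, h, hh, hyh⟩, u, ⟨hum, h', hh', huh⟩, hyu⟩ := hy
  have hmem {k : ℝ → Fin n → Fin n → L2 Ω} (hk : MemLp k 2 (timeMeasure T)) :
      MemLp (fun s => ∑ i, k s i i) 2 (timeMeasure T) := by
    refine memLp_finsetSum _ fun i _ => ?_
    exact ((ContinuousLinearMap.proj (R := ℝ) (φ := fun _ : Fin n => L2 Ω) i).comp
      (ContinuousLinearMap.proj (R := ℝ) (φ := fun _ : Fin n => Fin n → L2 Ω) i)).comp_memLp' hk
  have hl : ∀ᵐ s ∂timeMeasure T, IsLaplacian (y s) (∑ i, h s i i) := by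
    filter_upwards [hyh] with s hs using isLaplacian_of_isWeakHessian hs
  have hz : ∀ᵐ s ∂timeMeasure T, IsLaplacian (u s) (∑ i, h' s i i) := by
    filter_upwards [huh] with s hs using isLaplacian_of_isWeakHessian hs
  exact ⟨_, _, hl, hmem hh, hmem hh', hasWeakTimeDeriv_laplacian (J := toL2 Ω) (D := grad Ω)
    (denseRange_toL2 hΩ) hym hum hyu (hmem hh) (hmem hh') hl hz⟩

end Heat

end HeatPG

theorem corollaryC :
    ∃ C : ℝ, 0 < C ∧
      ∀ (n : ℕ), (n = 2 ∨ n = 3) →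
      ∀ (Ω : Set (Space n)), IsConvexPolygonalDomain Ω →
      ∀ (T : ℝ), 0 < T →
      ∀ (f : ℝ → Hneg1 Ω) (κ : L2 Ω) (y : ℝ → H10 Ω),
        MemLp f 2 (timeMeasure T) →
        IsWeakSolution T f κ y →
        (RegularData T f κ ∨ (MemH1H2 T y ∧ ∃ y'' : ℝ → L2 Ω, IsSecondTimeDeriv T y y'')) →
        ∃ ytt ytL : ℝ → L2 Ω,
          IsSecondTimeDeriv T y ytt ∧ IsTimeDerivLaplacian T y ytL ∧
          ∀ (M : ℕ) (t : ℕ → ℝ), IsPartition T M t →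
          ∀ yk : ℝ → H10 Ω, IsDiscreteSolution T M t f κ yk →
            eLpNorm (fun s => toL2 Ω (yk s - meanProj M t y s)) 2 (timeMeasure T) ≤
              ENNReal.ofReal (C * meshSize M t ^ 2) *
                (eLpNorm ytt 2 (timeMeasure T) + eLpNorm ytL 2 (timeMeasure T)) := by
  -- `C = 1` suffices: `error_estimate` bounds the error by `k² ‖∂ₜΔy‖`, and adding the other norm
  -- only enlarges the bound.
  refine ⟨1, one_pos, fun n _ Ω hΩ T hT f κ y hf hy hreg => ?_⟩
  have hΩo : IsOpen Ω := by
    obtain ⟨-, S, -, rfl⟩ := hΩ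
    exact isOpen_interior
  obtain ⟨ytt, ytL, htt, htL⟩ : ∃ ytt ytL : ℝ → L2 Ω,
      IsSecondTimeDeriv T y ytt ∧ IsTimeDerivLaplacian T y ytL := by
    rcases hreg with h | ⟨h, ytt, htt⟩
    · exact exists_timeDerivs_of_regularData hΩo hT hf hy h
    · obtain ⟨ytL, htL⟩ := exists_timeDerivLaplacian_of_memH1H2 hΩo h
      exact ⟨ytt, ytL, htt, htL⟩
  refine ⟨ytt, ytL, htt, htL, fun M t ht yk hyk => ?_⟩
  rw [one_mul]
  exact (error_estimate hT hy htL ht hyk).trans (mul_le_mul_right le_add_self _)
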